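/- Let $d\ge 1$, let $\chi$ be a finite set of spins, $H:\chi^2\to\mathbb{R}\cup\{\infty\}$ symmetric and $h:\chi\to\mathbb{R}$. For a finite $\Lambda\subset\mathbb{Z}^d$ with its induced nearest-neighbour graph let $Z_\Lambda=\sum_{\sigma\in\chi^\Lambda}\exp\big(-\sum_{\{u,v\}\in E(\Lambda)}H(\sigma_u,\sigma_v)-\sum_{v\in\Lambda}h(\sigma_v)\big)$, and let $\mathbb{P}_\Lambda$ be the corresponding finite-volume Gibbs measure. For $A\subset\mathbb{Z}^d$ let $\partial A$ be the set of sites of $A$ with a neighbour outside $A$, and let $B_r(X)$ be the set of sites at graph distance at most $r$ from $X$. Strong spatial mixing (SSM): for every finite $X\subset\mathbb{Z}^d$ and every $Y\subset\mathbb{Z}^d$ there is $R:\mathbb{N}\to\mathbb{R}$ with $R(r)\to0$ such that for all $r\ge1$ the conditional probability of $\{\sigma_v=s^1_v,\ v\in X\}$, given $\sigma=s^2$ on $Y$ and $\sigma=s^3$ on $\partial B_r(X)$, changes by at most $R(r)$ when $s^3$ is replaced by $s^4$, for all assignments $s^1,s^2,s^3,s^4$ for which both conditional probabilities are defined. (By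 the spatial Markov property they are conditional probabilities of $\mathbb{P}_{B_r(X)}$.) SSM is exponential if one can take $R(r)=\kappa e^{-\gamma r}$ with $\kappa,\gamma>0$. Let $\prec$ be the lexicographic order on $\mathbb{Z}^d$ in which the last coordinate is the most significant one. For $D\subset\mathbb{Z}^d$ with $0\in D$ and $s\in\chi$ write $\mathbb{P}_D(\sigma_0=s\mid\mathcal{E}_s)$ for the probability of $\sigma_0=s$ under the Gibbs measure of the model on the graph induced by $D$ in which all spins at sites $u\in D$, $u\succ 0$, are fixed to $s$; it is well defined if this Gibbs measure is unique. Write $\mathbb{P}=\mathbb{P}_{\mathbb{Z}^d}$, and for $1\le j\le d$, $k\ge0$ let $\mathbb{Z}^d_{j,k,+}=\{v:v_j\le k\}$, $\mathbb{Z}^d_{j,k,-}=\{v:v_j\ge-k\}$. Theorem. Suppose that the model on $\mathbb{Z}^d$ satisfies SSM and that $s^*\in\chi$ is such that $H(s,s^*)<\infty$ for all $s\in\chi$. Then $\mathbb{P}(\sigma_0=s^*\mid\mathcal{E}_{s^*})$ is well defined and positive, and the free energy $$\mathcal{P}=\lim_{n\to\infty}\frac{\log Z_{\Lambda_n}}{|\Lambda_n|}$$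 exists along every sequence of non-empty finite sets $\Lambda_n\subset\mathbb{Z}^d$ with $|\partial\Lambda_n|/|\Lambda_n|\to0$ and equals $$\mathcal{P}=-\log\mathbb{P}(\sigma_0=s^*\mid\mathcal{E}_{s^*})-dH(s^*,s^*)-h(s^*).$$ Suppose in addition that SSM is exponential and that the probabilities $\mathbb{P}_{\mathbb{Z}^d_{j,k,\pm}}(\sigma_0=s^*\mid\mathcal{E}_{s^*})$ are well defined (that is, the corresponding Gibbs measures are unique) for all $1\le j\le d$ and $k\ge0$. Then these probabilities are positive. For $a\in\mathbb{R}_{>0}^d$ let $B_{an}=\{u\in\mathbb{Z}^d:|u_j|\le a_jn,\ 1\le j\le d\}$, $A_j(a)=\prod_{i\ne j}(2a_i)$ and $A(a)=\sum_jA_j(a)$. Then for every $a\in\mathbb{R}_{>0}^d$ the surface pressure $$s\mathcal{P}(a)=\lim_{n\to\infty}\frac{\log Z_{B_{an}}-|B_{an}|\,\mathcal{P}}{A(a)\,n^{d-1}}$$ exists and equals $$s\mathcal{P}(a)=H(s^*,s^*)+\sum_{j=1}^d\frac{A_j(a)}{A(a)}\sum_{k=0}^\infty\Big(2\log\mathbb{P}(\sigma_0=s^*\mid\mathcal{E}_{s^*})-\log\mathbb{P}_{\mathbb{Z}^d_{j,k,+}}(\sigma_0=s^*\mid\mathcal{E}_{s^*})-\log\mathbb{P}_{\mathbb{Z}^d_{j,k,-}}(\sigma_0=s^*\mid\mathcal{E}_{s^*})\Big),$$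 where the infinite sums converge. -/

import Mathlib

noncomputable section

namespace SpinModel

open Filter Topology MeasureTheory

/-- The vertices of the lattice `ℤ^d`. -/
abbrev Site (d : ℕ) : Type := Fin d → ℤ

/-- The `ℓ¹` distance on `ℤ^d`; it is also the graph distance of the lattice. -/
def l1 {d : ℕ} (u v : Site d) : ℕ := ∑ i, (u i - v i).natAbs

/-- Nearest neighbours in `ℤ^d`. -/
def Adj {d : ℕ} (u v : Site d) : Prop := l1 u v = 1

/-- The lexicographic order `v ≺ u` on `ℤ^d`, in which the last coordinate is the most
significant one. -/
def LexLT {d : ℕ} (v u : Site d) : Prop := ∃ k, v k < u k ∧ ∀ j, k < j → v j = u j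

/-- `B_r(X)`, the set of sites at distance at most `r` from the finite set `X`. -/
def ball {d : ℕ} (X : Finset (Site d)) (r : ℕ) : Finset (Site d) :=
  X.biUnion fun v =>
    (Finset.Icc (fun i => v i - (r : ℤ)) (fun i => v i + (r : ℤ))).filter fun u => l1 u v ≤ r

theorem mem_ball {d : ℕ} {X : Finset (Site d)} {r : ℕ} {u : Site d} :
    u ∈ ball X r ↔ ∃ v ∈ X, l1 u v ≤ r := by
  simp only [ball, Finset.mem_biUnion, Finset.mem_filter, Finset.mem_Icc]
  refine exists_congr fun v => and_congr_right fun _ => ⟨fun h => h.2, fun h => ⟨?_, h⟩⟩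
  have key : ∀ i, (u i - v i).natAbs ≤ r := fun i =>
    (Finset.single_le_sum (f := fun i => (u i - v i).natAbs) (fun _ _ => Nat.zero_le _)
      (Finset.mem_univ i)).trans h
  constructor <;> intro i <;> have := key i <;> simp only <;> omega

/-- The (inner) boundary of `A` in the subgraph of `ℤ^d` induced by `D`:
the sites of `A` with a neighbour in `D` outside `A`. -/
def bdry {d : ℕ} (D A : Set (Site d)) : Set (Site d) :=
  {v | v ∈ A ∧ ∃ u ∈ D, Adj v u ∧ u ∉ A}

/-- The box `B_{an} = {u : |u_j| ≤ a_j n}`. -/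
def box {d : ℕ} (a : Fin d → ℝ) (n : ℕ) : Finset (Site d) :=
  Finset.Icc (fun j => -⌊a j * n⌋) (fun j => ⌊a j * n⌋)

theorem mem_box {d : ℕ} {a : Fin d → ℝ} {n : ℕ} {u : Site d} :
    u ∈ box a n ↔ ∀ j, |(u j : ℝ)| ≤ a j * n := by
  simp only [box, Finset.mem_Icc, Pi.le_def, ← forall_and]
  refine forall_congr' fun j => ?_
  rw [abs_le, Int.le_floor, neg_le, Int.le_floor, neg_le (a := a j * (n : ℝ))]
  push_cast
  rfl

/-- The half-space `ℤ^d_{j,k,+}`. -/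
def halfPlus {d : ℕ} (j : Fin d) (k : ℕ) : Set (Site d) := {v | v j ≤ (k : ℤ)}

/-- The half-space `ℤ^d_{j,k,-}`. -/
def halfMinus {d : ℕ} (j : Fin d) (k : ℕ) : Set (Site d) := {v | -(k : ℤ) ≤ v j}

/-- `A_j(a) = ∏_{i ≠ j} 2 a_i`. -/
def faceArea {d : ℕ} (a : Fin d → ℝ) (j : Fin d) : ℝ := ∏ i ∈ Finset.univ.erase j, 2 * a i

/-- `A(a) = ∑_j A_j(a)`. -/
def area {d : ℕ} (a : Fin d → ℝ) : ℝ := ∑ j, faceArea a j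

section Model

variable {d : ℕ} {χ : Type*} (H : χ → χ → WithTop ℝ) (h : χ → ℝ)

/-- The Boltzmann factor `exp (-x)`, with `exp (-∞) = 0`. -/
def boltzmann : WithTop ℝ → ℝ
  | ⊤ => 0
  | (x : ℝ) => Real.exp (-x)

open scoped Classical in
/-- The energy of a configuration on the graph induced by the finite set `Λ`. Each undirected edge
is listed once, through its endpoints in increasing lexicographic order. -/
def energy (Λ : Finset (Site d)) (σ : Λ → χ) : WithTop ℝ :=
  (∑ p ∈ (Finset.univ : Finset (Λ × Λ)).filter
      (fun p => Adj (p.1 : Site d) p.2 ∧ LexLT (p.1 : Site d) p.2), H (σ p.1) (σ p.2))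
    + ∑ v, ((h (σ v) : ℝ) : WithTop ℝ)

/-- The unnormalized Gibbs weight of a configuration on `Λ`. -/
def weight (Λ : Finset (Site d)) (σ : Λ → χ) : ℝ := boltzmann (energy H h Λ σ)

/-- The configurations on the set `D` of sites that agree with `τ` at the sites of `S`. -/
def agree (D : Set (Site d)) (S : Set (Site d)) (τ : Site d → χ) : Set (D → χ) :=
  {σ | ∀ v : D, (v : Site d) ∈ S → σ v = τ v}

variable [Fintype χ]

/-- The partition function `Z_Λ`. -/
def partitionFn (Λ : Finset (Site d)) : ℝ := ∑ σ : Λ → χ, weight H h Λ σ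

/-- The total weight of an event on `Λ`, i.e. `Z_Λ · ℙ_Λ(E)`. -/
def mass (Λ : Finset (Site d)) (E : Set (Λ → χ)) : ℝ :=
  ∑ σ : Λ → χ, E.indicator (weight H h Λ) σ

/-- The conditional probability `ℙ_Λ(E | F)` under the finite-volume Gibbs measure on the graph
induced by `Λ`; it is meaningful if `mass H h Λ F ≠ 0`. -/
def condProb (Λ : Finset (Site d)) (E F : Set (Λ → χ)) : ℝ :=
  mass H h Λ (E ∩ F) / mass H h Λ F

/-- The conditioning event of strong spatial mixing: spins `s₂` on `Y` and `s₃` on the boundary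
of `B_r(X)`. -/
def ssmEvent (X : Finset (Site d)) (Y : Set (Site d)) (r : ℕ) (s₂ s₃ : Site d → χ) :
    Set (ball X r → χ) :=
  agree (ball X r) Y s₂ ∩ agree (ball X r) (bdry Set.univ (ball X r)) s₃

/-- `R` bounds the influence on `X`, given the spins on `Y`, of the spins on the boundary of
`B_r(X)`. By the spatial Markov property, the law of the spins of `X` given those on `Y` and on the
boundary of `B_r(X)` is that of the finite-volume model on `B_r(X)`. The assignments range over
those for which the conditional probabilities are defined. -/
def IsSSMRate (X : Finset (Site d)) (Y : Set (Site d)) (R : ℕ → ℝ) : Prop :=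
  ∀ r : ℕ, 1 ≤ r → ∀ s₁ s₂ s₃ s₄ : Site d → χ,
    mass H h (ball X r) (ssmEvent X Y r s₂ s₃) ≠ 0 →
    mass H h (ball X r) (ssmEvent X Y r s₂ s₄) ≠ 0 →
    |condProb H h (ball X r) (agree (ball X r) X s₁) (ssmEvent X Y r s₂ s₃)
      - condProb H h (ball X r) (agree (ball X r) X s₁) (ssmEvent X Y r s₂ s₄)| ≤ R r

variable (d) in
/-- Strong spatial mixing of the model on `ℤ^d`. -/
def SSM : Prop :=
  ∀ (X : Finset (Site d)) (Y : Set (Site d)),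
    ∃ R : ℕ → ℝ, Tendsto R atTop (𝓝 0) ∧ IsSSMRate H h X Y R

variable (d) in
/-- Exponential strong spatial mixing of the model on `ℤ^d`. -/
def ExpSSM : Prop :=
  ∀ (X : Finset (Site d)) (Y : Set (Site d)),
    ∃ κ γ : ℝ, 0 < κ ∧ 0 < γ ∧ IsSSMRate H h X Y fun r => κ * Real.exp (-γ * r)

/-- `μ` is a Gibbs measure, on the subgraph of `ℤ^d` induced by `D`, of the model in which the
spins at the sites of `Y` are fixed to the values `η`. The field `markov` is the spatial Markov
property: given the spins on the boundary of a finite set `A`, the spins in `A` follow the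
finite-volume Gibbs measure on `A`. (Where the finite-volume conditional probability is not defined,
it is `0`, so that forbidden configurations get probability `0`.) -/
structure IsGibbs [MeasurableSpace χ] (D Y : Set (Site d)) (η : Site d → χ)
    (μ : Measure (D → χ)) : Prop where
  prob : IsProbabilityMeasure μ
  fixed : ∀ᵐ σ ∂μ, σ ∈ agree D Y η
  markov : ∀ A : Finset (Site d), (A : Set (Site d)) ⊆ D → ∀ ω : Site d → χ,
    μ.real (agree D A ω) =
      condProb H h A (agree A A ω) (agree A (bdry D A ∪ (Y ∩ A)) ω)
        * μ.real (agree D (bdry D A ∪ (Y ∩ A)) ω)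

/-- `ℙ_D(σ_0 = s | σ_u = s for all u ≻ 0)` is well defined and equal to `p`: the model on `D` in
which all sites `u ≻ 0` have the spin `s` has exactly one Gibbs measure, and it gives the event
`σ_0 = s` the probability `p`. -/
def IsCavityMarginal [MeasurableSpace χ] (D : Set (Site d)) (s : χ) (p : ℝ) : Prop :=
  ∃ μ : Measure (D → χ),
    (∀ ν : Measure (D → χ), IsGibbs H h D {u | LexLT 0 u} (fun _ => s) ν ↔ ν = μ) ∧
    μ.real (agree D {0} fun _ => s) = p

variable (d) in
/-- `P` is the free energy (pressure) of the model: the limit of `log Z_{Λ_n} / |Λ_n|` along every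
sequence of finite sets whose boundary is negligible with respect to their volume. -/
def IsFreeEnergy (P : ℝ) : Prop :=
  ∀ Λ : ℕ → Finset (Site d), (∀ n, (Λ n).Nonempty) →
    Tendsto (fun n => ((bdry Set.univ (Λ n : Set (Site d))).ncard : ℝ) / (Λ n).card) atTop (𝓝 0) →
    Tendsto (fun n => Real.log (partitionFn H h (Λ n)) / (Λ n).card) atTop (𝓝 P)

/-- `L` is the surface pressure for the boxes `B_{an}`, where `P` is the free energy. -/
def IsSurfacePressure (P : ℝ) (a : Fin d → ℝ) (L : ℝ) : Prop :=
  Tendsto (fun n : ℕ =>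
      (Real.log (partitionFn H h (box a n)) - (box a n).card * P) / (area a * (n : ℝ) ^ (d - 1)))
    atTop (𝓝 L)

end Model

end SpinModel

end

/-!
Write `s` for the reference spin. Conditioning on the spins being `s` one site at a time, from the
lexicographically largest site of `Λ` downwards, factors the Gibbs probability of the constant
configuration `s` into conditional probabilities; each of them is, after a translation, the
probability of `σ_0 = s` given `ℰ_s` for the translate of `Λ` that moves the current site to `0`.
The weight of the constant configuration is explicit, so `log Z_Λ` is a sum over the sites of `Λ`.

By strong spatial mixing such a probability depends on the shape of the domain only near `0`. Sites
far from the boundary of `Λ` therefore contribute the value for `ℤ^d`, which gives the free energy.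
For the surface pressure, the differences to that value decay exponentially with the distance to
the boundary of the box. A partition of unity distributes them among the faces. The sites at a given
distance from a face are, up to a negligible fraction, far from the other faces, so the domain looks
like a half-space to them, and dominated convergence sums the contributions of all distances.
-/

noncomputable section

namespace SpinModel

open Filter Topology MeasureTheory

theorem boltzmann_nonneg (x : WithTop ℝ) : 0 ≤ boltzmann x := by
  cases x with
  | top => exact le_rfl
  | coe x => exact (Real.exp_pos _).le

theorem boltzmann_pos {x : WithTop ℝ} (hx : x ≠ ⊤) : 0 < boltzmann x := by
  lift x to ℝ using hx
  exact Real.exp_pos _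

theorem boltzmann_coe (x : ℝ) : boltzmann x = Real.exp (-x) := rfl

theorem boltzmann_zero : boltzmann 0 = 1 := by
  simpa using boltzmann_coe 0

theorem boltzmann_add (x y : WithTop ℝ) : boltzmann (x + y) = boltzmann x * boltzmann y := by
  cases x with
  | top => rw [top_add]; exact (zero_mul _).symm
  | coe x =>
    cases y with
    | top => rw [add_top]; exact (mul_zero _).symm
    | coe y => simp only [← WithTop.coe_add, boltzmann_coe, neg_add, Real.exp_add]

theorem boltzmann_sum {ι : Type*} (t : Finset ι) (f : ι → WithTop ℝ) :
    boltzmann (∑ i ∈ t, f i) = ∏ i ∈ t, boltzmann (f i) := by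
  classical
  induction t using Finset.induction_on with
  | empty => exact boltzmann_zero
  | insert a t ha ih => rw [Finset.sum_insert ha, Finset.prod_insert ha, boltzmann_add, ih]

section Weights

variable {d : ℕ} {χ : Type*} (H : χ → χ → WithTop ℝ) (h : χ → ℝ)

theorem adj_comm {u v : Site d} : Adj u v ↔ Adj v u := by
  simp only [Adj, l1, ← Int.natAbs_neg (u _ - v _), neg_sub]

/-- The configuration on the lattice that equals `σ` on `D` and `η` elsewhere. -/
def extend (D : Set (Site d)) (η : Site d → χ) (σ : D → χ) : Site d → χ :=
  Function.extend Subtype.val σ η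

theorem extend_coe (D : Set (Site d)) (η : Site d → χ) (σ : D → χ) (v : D) :
    extend D η σ v = σ v :=
  Subtype.val_injective.extend_apply σ η v

theorem extend_of_notMem {D : Set (Site d)} {v : Site d} (hv : v ∉ D) (η : Site d → χ)
    (σ : D → χ) : extend D η σ v = η v :=
  Function.extend_apply' _ _ _ fun ⟨u, hu⟩ => hv (hu ▸ u.2)

open scoped Classical in
/-- The contribution of the ordered pair `p` of sites to the weight of `σ`; it is trivial unless `p`
is an edge listed in increasing lexicographic order. -/
def pairFactor (σ : Site d → χ) (p : Site d × Site d) : ℝ :=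
  if Adj p.1 p.2 ∧ LexLT p.1 p.2 then boltzmann (H (σ p.1) (σ p.2)) else 1

/-- The Gibbs weight on `Λ` as a function of configurations on the whole lattice, which can be
compared for different `Λ`. -/
def globalWeight (Λ : Finset (Site d)) (σ : Site d → χ) : ℝ :=
  (∏ p ∈ Λ ×ˢ Λ, pairFactor H σ p) * ∏ v ∈ Λ, Real.exp (-h (σ v))

/-- The part of the weight on `Λ` that does not come from the graph induced by `A`. -/
def outerWeight (A Λ : Finset (Site d)) (σ : Site d → χ) : ℝ :=
  (∏ p ∈ (Λ ×ˢ Λ) \ (A ×ˢ A), pairFactor H σ p) * ∏ v ∈ Λ \ A, Real.exp (-h (σ v))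

theorem weight_nonneg (Λ : Finset (Site d)) (σ : Λ → χ) : 0 ≤ weight H h Λ σ :=
  boltzmann_nonneg _

theorem weight_restrict (Λ : Finset (Site d)) (σ : Site d → χ) :
    weight H h Λ (fun v => σ v) = globalWeight H h Λ σ := by
  classical
  rw [weight, energy, boltzmann_add, boltzmann_sum, boltzmann_sum, globalWeight, Finset.prod_filter,
    ← Finset.univ_product_univ]
  simp only [Finset.prod_product, ← Finset.prod_coe_sort Λ, boltzmann_coe, pairFactor]

theorem globalWeight_eq_mul_outerWeight {A Λ : Finset (Site d)} (hA : A ⊆ Λ) (σ : Site d → χ) :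
    globalWeight H h Λ σ = globalWeight H h A σ * outerWeight H h A Λ σ := by
  unfold globalWeight outerWeight
  rw [← Finset.prod_sdiff (Finset.product_subset_product hA hA), ← Finset.prod_sdiff hA]
  ring

theorem pairFactor_congr {σ τ : Site d → χ} {p : Site d × Site d}
    (hp : Adj p.1 p.2 → σ p.1 = τ p.1 ∧ σ p.2 = τ p.2) : pairFactor H σ p = pairFactor H τ p := by
  unfold pairFactor
  split_ifs with hadj
  · rw [(hp hadj.1).1, (hp hadj.1).2]
  · rfl

theorem outerWeight_congr {A Λ : Finset (Site d)} {σ τ : Site d → χ}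
    (hout : ∀ v ∈ Λ, v ∉ A → σ v = τ v) (hbdry : ∀ v ∈ bdry (Λ : Set (Site d)) A, σ v = τ v) :
    outerWeight H h A Λ σ = outerWeight H h A Λ τ := by
  have agree_of_adj : ∀ {u v}, u ∈ Λ → v ∈ Λ → Adj u v → ¬(u ∈ A ∧ v ∈ A) → σ u = τ u := by
    intro u v hu hv huv hA
    by_cases huA : u ∈ A
    · exact hbdry u ⟨huA, v, hv, huv, fun hvA => hA ⟨huA, hvA⟩⟩
    · exact hout u hu huA
  unfold outerWeight
  congr 1
  · refine Finset.prod_congr rfl fun p hp => pairFactor_congr H fun hadj => ?_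
    simp only [Finset.mem_sdiff, Finset.mem_product] at hp
    exact ⟨agree_of_adj hp.1.1 hp.1.2 hadj hp.2,
      agree_of_adj hp.1.2 hp.1.1 (adj_comm.1 hadj) fun hA => hp.2 hA.symm⟩
  · refine Finset.prod_congr rfl fun v hv => ?_
    rw [Finset.mem_sdiff] at hv
    rw [hout v hv.1 hv.2]

end Weights

section Mass

variable {d : ℕ} {χ : Type*} (H : χ → χ → WithTop ℝ) (h : χ → ℝ)

theorem mem_agree {D S : Set (Site d)} {τ : Site d → χ} {σ : D → χ} :
    σ ∈ agree D S τ ↔ ∀ v : D, (v : Site d) ∈ S → σ v = τ v := Iff.rfl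

theorem agree_antitone (D : Set (Site d)) (τ : Site d → χ) :
    Antitone fun S => agree D S τ :=
  fun _ _ hST _ hσ v hv => hσ v (hST hv)

theorem agree_congr {D S : Set (Site d)} {τ τ' : Site d → χ} (hτ : ∀ v ∈ D, v ∈ S → τ v = τ' v) :
    agree D S τ = agree D S τ' :=
  Set.ext fun _ => forall₂_congr fun v hv => by rw [hτ v v.2 hv]

theorem weight_eq_globalWeight_extend (Λ : Finset (Site d)) (η : Site d → χ) (σ : Λ → χ) :
    weight H h Λ σ = globalWeight H h Λ (extend Λ η σ) := by
  rw [← weight_restrict]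
  exact congrArg _ (funext fun v => (extend_coe (Λ : Set (Site d)) η σ v).symm)

theorem piFinsetUnion_eq_extend {A B : Finset (Site d)} (hAB : Disjoint A B)
    (η : Site d → χ) (τ : A → χ) (ξ : B → χ) (v : ↥(A ∪ B)) :
    Equiv.piFinsetUnion (fun _ => χ) hAB (τ, ξ) v = extend A (extend B η ξ) τ v := by
  obtain ⟨v, hv⟩ := v
  by_cases hvA : v ∈ A
  · rw [Equiv.piFinsetUnion_left _ hAB hvA hv]
    exact (extend_coe (A : Set (Site d)) _ τ ⟨v, hvA⟩).symm
  · have hvB : v ∈ B := (Finset.mem_union.1 hv).resolve_left hvA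
    rw [Equiv.piFinsetUnion_right _ hAB hvB hv, extend_of_notMem (mt Finset.mem_coe.1 hvA)]
    exact (extend_coe (B : Set (Site d)) η ξ ⟨v, hvB⟩).symm

theorem weight_piFinsetUnion {A B : Finset (Site d)} (hAB : Disjoint A B) {ω : Site d → χ}
    {τ : A → χ} (hτ : τ ∈ agree A (bdry (A ∪ B : Finset (Site d)) A) ω) (ξ : B → χ) :
    weight H h (A ∪ B) (Equiv.piFinsetUnion (fun _ => χ) hAB (τ, ξ)) =
      weight H h A τ * outerWeight H h A (A ∪ B) (extend B ω ξ) := by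
  rw [funext (piFinsetUnion_eq_extend hAB ω τ ξ), weight_restrict,
    globalWeight_eq_mul_outerWeight H h Finset.subset_union_left, ← weight_eq_globalWeight_extend]
  congr 1
  refine outerWeight_congr H h (fun v _ hvA => extend_of_notMem (mt Finset.mem_coe.1 hvA) _ _)
    fun v hv => ?_
  have hvA : v ∈ A := hv.1
  have hvB : v ∉ B := Finset.disjoint_left.1 hAB hvA
  exact (extend_coe (A : Set (Site d)) _ τ ⟨v, hvA⟩).trans ((hτ ⟨v, hvA⟩ hv).trans
    (extend_of_notMem (mt Finset.mem_coe.1 hvB) _ _).symm)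

theorem piFinsetUnion_mem_agree_iff {A B : Finset (Site d)} (hAB : Disjoint A B)
    {S : Set (Site d)} {η : Site d → χ} {τ : A → χ} {ξ : B → χ} :
    Equiv.piFinsetUnion (fun _ => χ) hAB (τ, ξ) ∈ agree (A ∪ B : Finset (Site d)) S η ↔
      τ ∈ agree A S η ∧ ξ ∈ agree B S η := by
  constructor
  · refine fun hσ => ⟨fun v hv => ?_, fun v hv => ?_⟩
    · exact (Equiv.piFinsetUnion_left _ hAB v.2 _).symm.trans
        (hσ ⟨v, Finset.mem_union_left B v.2⟩ hv)
    · exact (Equiv.piFinsetUnion_right _ hAB v.2 _).symm.trans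
        (hσ ⟨v, Finset.mem_union_right A v.2⟩ hv)
  · rintro ⟨hτ, hξ⟩ ⟨v, hv⟩ hvS
    rcases Finset.mem_union.1 hv with hvA | hvB
    · exact (Equiv.piFinsetUnion_left _ hAB hvA hv).trans (hτ ⟨v, hvA⟩ hvS)
    · exact (Equiv.piFinsetUnion_right _ hAB hvB hv).trans (hξ ⟨v, hvB⟩ hvS)

variable [Fintype χ]

theorem mass_nonneg (Λ : Finset (Site d)) (E : Set (Λ → χ)) : 0 ≤ mass H h Λ E :=
  Finset.sum_nonneg fun _ _ => Set.indicator_nonneg (fun _ _ => weight_nonneg H h Λ _) _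

theorem mass_mono {Λ : Finset (Site d)} {E F : Set (Λ → χ)} (hEF : E ⊆ F) :
    mass H h Λ E ≤ mass H h Λ F :=
  Finset.sum_le_sum fun _ _ =>
    Set.indicator_le_indicator_of_subset hEF (fun _ => weight_nonneg H h Λ _) _

theorem mass_empty (Λ : Finset (Site d)) : mass H h Λ ∅ = 0 := by
  simp only [mass, Set.indicator_empty, Finset.sum_const_zero]

theorem condProb_nonneg (Λ : Finset (Site d)) (E F : Set (Λ → χ)) : 0 ≤ condProb H h Λ E F :=
  div_nonneg (mass_nonneg H h Λ _) (mass_nonneg H h Λ _)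

theorem condProb_mul_mass (Λ : Finset (Site d)) (E F : Set (Λ → χ)) :
    condProb H h Λ E F * mass H h Λ F = mass H h Λ (E ∩ F) :=
  div_mul_cancel_of_imp fun hF =>
    le_antisymm ((mass_mono H h Set.inter_subset_right).trans_eq hF) (mass_nonneg H h Λ _)

/-- The sum, over the configurations on `B` that agree with `η` on `Y`, of the part of the weight on
`A ∪ B` that does not come from the graph induced by `A`, when the spins in `A` are given by `ω`. -/
def outerMass (A B : Finset (Site d)) (Y : Set (Site d)) (η ω : Site d → χ) : ℝ :=
  ∑ ξ : B → χ, (agree B Y η).indicator (fun ξ => outerWeight H h A (A ∪ B) (extend B ω ξ)) ξ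

/-- The spatial Markov property: an edge with an endpoint outside `A` sees of the spins in `A` only
those on the boundary. -/
theorem mass_agree_inter_agree {A B : Finset (Site d)} (hAB : Disjoint A B) {S Y : Set (Site d)}
    (hS : bdry (A ∪ B : Finset (Site d)) A ∪ (Y ∩ A) ⊆ S) (hSA : S ⊆ A) {η ω : Site d → χ}
    (hω : ∀ v ∈ Y, v ∈ A → ω v = η v) :
    mass H h (A ∪ B) (agree (A ∪ B : Finset (Site d)) S ω ∩ agree (A ∪ B : Finset (Site d)) Y η) =
      mass H h A (agree A S ω) * outerMass H h A B Y η ω := by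
  have mem_iff (τ : A → χ) (ξ : B → χ) : Equiv.piFinsetUnion (fun _ => χ) hAB (τ, ξ) ∈
      agree (A ∪ B : Finset (Site d)) S ω ∩ agree (A ∪ B : Finset (Site d)) Y η ↔
        τ ∈ agree A S ω ∧ ξ ∈ agree B Y η := by
    refine Set.mem_inter_iff _ _ _ |>.trans ?_
    rw [piFinsetUnion_mem_agree_iff, piFinsetUnion_mem_agree_iff]
    refine ⟨fun hσ => ⟨hσ.1.1, hσ.2.2⟩, fun ⟨hτ, hξ⟩ => ⟨⟨hτ, fun v hv => ?_⟩, fun v hv => ?_, hξ⟩⟩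
    · exact absurd v.2 (Finset.disjoint_left.1 hAB (hSA hv))
    · exact (hτ v (hS (Or.inr ⟨hv, v.2⟩))).trans (hω v hv v.2)
  rw [mass, mass, outerMass, ← (Equiv.piFinsetUnion (fun _ => χ) hAB).sum_comp,
    Fintype.sum_prod_type, Finset.sum_mul_sum]
  refine Finset.sum_congr rfl fun τ _ => Finset.sum_congr rfl fun ξ _ => ?_
  by_cases hτ : τ ∈ agree A S ω
  · by_cases hξ : ξ ∈ agree B Y η
    · rw [Set.indicator_of_mem ((mem_iff τ ξ).2 ⟨hτ, hξ⟩), Set.indicator_of_mem hτ,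
        Set.indicator_of_mem hξ,
        weight_piFinsetUnion H h hAB (agree_antitone _ ω (Set.subset_union_left.trans hS) hτ)]
    · rw [Set.indicator_of_notMem hξ, mul_zero,
        Set.indicator_of_notMem fun hm => hξ ((mem_iff τ ξ).1 hm).2]
  · rw [Set.indicator_of_notMem hτ, zero_mul,
      Set.indicator_of_notMem fun hm => hτ ((mem_iff τ ξ).1 hm).1]

theorem condProb_agree_mul_condProb_agree {A Λ : Finset (Site d)} (hA : A ⊆ Λ) (Y : Set (Site d))
    (η ω : Site d → χ) :
    condProb H h Λ (agree Λ A ω) (agree Λ Y η) =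
      condProb H h A (agree A A ω) (agree A (bdry Λ A ∪ (Y ∩ A)) ω) *
        condProb H h Λ (agree Λ (bdry Λ A ∪ (Y ∩ A)) ω) (agree Λ Y η) := by
  obtain ⟨B, hAB, rfl⟩ : ∃ B, Disjoint A B ∧ A ∪ B = Λ :=
    ⟨Λ \ A, Finset.disjoint_sdiff, Finset.union_sdiff_of_subset hA⟩
  set S := bdry (A ∪ B : Finset (Site d)) A ∪ (Y ∩ A)
  have hSA : S ⊆ A := Set.union_subset (fun v hv => hv.1) Set.inter_subset_right
  by_cases hω : ∀ v ∈ Y, v ∈ A → ω v = η v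
  · have agree_subset : agree (A : Set (Site d)) A ω ⊆ agree A S ω := agree_antitone _ ω hSA
    have condProb_eq {T : Set (Site d)} (hST : S ⊆ T) (hTA : T ⊆ A) :
        condProb H h (A ∪ B) (agree (A ∪ B : Finset (Site d)) T ω)
          (agree (A ∪ B : Finset (Site d)) Y η) = mass H h A (agree A T ω) *
            (outerMass H h A B Y η ω / mass H h (A ∪ B) (agree (A ∪ B : Finset (Site d)) Y η)) := by
      rw [condProb, mass_agree_inter_agree H h hAB hST hTA hω, mul_div_assoc]
    rw [condProb_eq hSA subset_rfl, condProb_eq subset_rfl hSA, ← mul_assoc, condProb_mul_mass,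
      Set.inter_eq_left.2 agree_subset]
  · push Not at hω
    obtain ⟨v, hvY, hvA, hv⟩ := hω
    have condProb_eq_zero : ∀ T : Set (Site d), v ∈ T → condProb H h (A ∪ B)
        (agree (A ∪ B : Finset (Site d)) T ω) (agree (A ∪ B : Finset (Site d)) Y η) = 0 := by
      intro T hvT
      have disjoint : agree (A ∪ B : Finset (Site d)) T ω ∩
          agree (A ∪ B : Finset (Site d)) Y η = ∅ :=
        Set.eq_empty_of_forall_notMem fun σ hσ =>
          hv ((hσ.1 ⟨v, Finset.mem_union_left B hvA⟩ hvT).symm.trans (hσ.2 ⟨v, _⟩ hvY))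
      rw [condProb, disjoint, mass_empty, zero_div]
    rw [condProb_eq_zero A hvA, condProb_eq_zero S (Or.inr ⟨hvY, hvA⟩), mul_zero]

end Mass

section FiniteVolume

variable {d : ℕ} {χ : Type*} (H : χ → χ → WithTop ℝ) (h : χ → ℝ) [Fintype χ] [MeasurableSpace χ]

/-- The finite-volume Gibbs measure on `Λ`, conditioned on the spins in `Y` being given by `η`. -/
def finiteGibbs (Λ : Finset (Site d)) (Y : Set (Site d)) (η : Site d → χ) :
    Measure (↥(Λ : Set (Site d)) → χ) :=
  ∑ σ : Λ → χ, ENNReal.ofReal ((agree (Λ : Set (Site d)) Y η).indicator (weight H h Λ) σ /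
    mass H h Λ (agree Λ Y η)) • Measure.dirac (α := ↥(Λ : Set (Site d)) → χ) σ

variable [MeasurableSingletonClass χ]

theorem finiteGibbs_apply (Λ : Finset (Site d)) (Y : Set (Site d)) (η : Site d → χ)
    (E : Set (Λ → χ)) :
    finiteGibbs H h Λ Y η E = ENNReal.ofReal (condProb H h Λ E (agree Λ Y η)) := by
  have hE : MeasurableSet (α := ↥(Λ : Set (Site d)) → χ) E :=
    (Set.toFinite (α := Λ → χ) E).measurableSet
  have mass_eq : mass H h Λ (E ∩ agree Λ Y η) =
      ∑ σ : Λ → χ, (E ∩ agree Λ Y η).indicator (weight H h Λ) σ := rfl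
  have weight_div_nonneg (σ : Λ → χ) : 0 ≤ (E ∩ agree Λ Y η).indicator (weight H h Λ) σ /
      mass H h Λ (agree Λ Y η) :=
    div_nonneg (Set.indicator_nonneg (fun _ _ => weight_nonneg H h Λ _) σ) (mass_nonneg H h Λ _)
  rw [finiteGibbs, Measure.finsetSum_apply, condProb,
    mass_eq, Finset.sum_div, ENNReal.ofReal_sum_of_nonneg fun σ _ => weight_div_nonneg σ]
  refine Finset.sum_congr rfl fun σ _ => ?_
  rw [Measure.smul_apply, Measure.dirac_apply' _ hE, smul_eq_mul, ← Set.indicator_indicator]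
  by_cases hσ : σ ∈ E
  · rw [Set.indicator_of_mem hσ, Set.indicator_of_mem hσ, Pi.one_apply, mul_one]
  · rw [Set.indicator_of_notMem hσ, Set.indicator_of_notMem hσ, mul_zero, zero_div,
      ENNReal.ofReal_zero]

theorem finiteGibbs_real (Λ : Finset (Site d)) (Y : Set (Site d)) (η : Site d → χ)
    (E : Set (Λ → χ)) :
    (finiteGibbs H h Λ Y η).real E = condProb H h Λ E (agree Λ Y η) := by
  rw [Measure.real, finiteGibbs_apply, ENNReal.toReal_ofReal (condProb_nonneg H h Λ _ _)]

theorem isGibbs_finiteGibbs {Λ : Finset (Site d)} {Y : Set (Site d)} {η : Site d → χ}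
    (hne : mass H h Λ (agree Λ Y η) ≠ 0) :
    IsGibbs H h (Λ : Set (Site d)) Y η (finiteGibbs H h Λ Y η) where
  prob := ⟨by rw [finiteGibbs_apply, condProb, Set.univ_inter, div_self hne, ENNReal.ofReal_one]⟩
  fixed := by
    refine (finiteGibbs_apply H h Λ Y η (agree Λ Y η)ᶜ).trans ?_
    rw [condProb, Set.compl_inter_self, mass_empty, zero_div, ENNReal.ofReal_zero]
  markov A hA ω := by
    rw [finiteGibbs_real, finiteGibbs_real]
    exact condProb_agree_mul_condProb_agree H h (Finset.coe_subset.1 hA) Y η ω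

end FiniteVolume

section Configurations

variable {d : ℕ} {χ : Type*} {D : Set (Site d)} {A : Finset (Site d)}

/-- The restriction of a configuration on `D` to a finite subset of `D`. -/
def restrictTo (hA : (A : Set (Site d)) ⊆ D) (σ : D → χ) : A → χ := fun v => σ ⟨v, hA v.2⟩

theorem agree_extend (D : Set (Site d)) (η : Site d → χ) (σ : D → χ) :
    agree D D (extend D η σ) = {σ} := by
  ext τ
  simp only [mem_agree, extend_coe, Subtype.coe_prop, forall_const, Set.mem_singleton_iff,
    funext_iff]

theorem preimage_restrictTo_agree (hA : (A : Set (Site d)) ⊆ D) {S : Set (Site d)} (hS : S ⊆ A)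
    (τ : Site d → χ) : restrictTo hA ⁻¹' agree A S τ = agree D S τ :=
  Set.ext fun _ => ⟨fun hσ v hv => hσ ⟨v, hS hv⟩ hv, fun hσ v hv => hσ ⟨v, hA v.2⟩ hv⟩

theorem preimage_restrictTo_singleton (hA : (A : Set (Site d)) ⊆ D) (η : Site d → χ) (τ : A → χ) :
    restrictTo hA ⁻¹' {τ} = agree D A (extend A η τ) := by
  rw [← preimage_restrictTo_agree hA subset_rfl]
  exact congrArg _ (agree_extend (A : Set (Site d)) η τ).symm

variable [MeasurableSpace χ]

theorem measurable_restrictTo (hA : (A : Set (Site d)) ⊆ D) :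
    Measurable (restrictTo (χ := χ) hA) :=
  measurable_pi_lambda _ fun _ => measurable_pi_apply _

variable [MeasurableSingletonClass χ]

theorem ext_of_agree [Finite χ] [Nonempty χ] {μ ν : Measure (D → χ)} [IsFiniteMeasure μ]
    [IsFiniteMeasure ν]
    (hμν : ∀ A : Finset (Site d), (A : Set (Site d)) ⊆ D → ∀ ω : Site d → χ,
      μ.real (agree D A ω) = ν.real (agree D A ω)) : μ = ν := by
  classical
  obtain ⟨x⟩ := ‹Nonempty χ›
  refine IsProjectiveLimit.unique (P := fun I : Finset D => ν.map I.restrict) (fun I => ?_)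
    fun I => rfl
  refine Measure.ext_of_singleton fun τ => ?_
  let ω : Site d → χ := extend D (fun _ => x) (Function.extend Subtype.val τ fun _ => x)
  have hω (v : I) : ω v = τ v :=
    (extend_coe D _ _ _).trans (Subtype.val_injective.extend_apply τ _ v)
  have preimage_eq : I.restrict (π := fun _ => χ) ⁻¹' {τ} =
      agree D (I.map (Function.Embedding.subtype (· ∈ D)) : Finset (Site d)) ω := by
    ext σ
    rw [Set.mem_preimage, Set.mem_singleton_iff, mem_agree, funext_iff]
    refine ⟨fun hσ v hv => ?_, fun hσ v => (hσ v (by simp)).trans (hω v)⟩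
    have hvI : v ∈ I := by simpa using hv
    exact (hσ ⟨v, hvI⟩).trans (hω ⟨v, hvI⟩).symm
  rw [Measure.map_apply (Finset.measurable_restrict I) (measurableSet_singleton τ),
    Measure.map_apply (Finset.measurable_restrict I) (measurableSet_singleton τ), preimage_eq,
    ← measureReal_eq_measureReal_iff]
  exact hμν _ (by simp) ω

end Configurations

theorem sum_measureReal_inter_preimage_singleton {Ω β : Type*} [MeasurableSpace Ω] [Fintype β]
    [MeasurableSpace β] [MeasurableSingletonClass β] (μ : Measure Ω) [IsFiniteMeasure μ]
    {f : Ω → β} (hf : Measurable f) (E : Set Ω) :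
    ∑ b, μ.real (E ∩ f ⁻¹' {b}) = μ.real E := by
  have measurable_fiber (b : β) : MeasurableSet (f ⁻¹' {b}) := hf (measurableSet_singleton b)
  have sum_restrict := sum_measureReal_preimage_singleton (μ := μ.restrict E) Finset.univ
    fun b _ => measurable_fiber b
  simpa only [measureReal_restrict_apply (measurable_fiber _), Set.inter_comm E, Finset.coe_univ,
    Set.preimage_univ, measureReal_restrict_apply_univ] using sum_restrict

section Mass

variable {d : ℕ} {χ : Type*} (H : χ → χ → WithTop ℝ) (h : χ → ℝ) [Fintype χ]

theorem mass_coe_finset (Λ : Finset (Site d)) (E : Finset (Λ → χ)) :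
    mass H h Λ E = ∑ σ ∈ E, weight H h Λ σ :=
  Finset.sum_indicator_subset _ E.subset_univ

theorem mass_agree_self (Λ : Finset (Site d)) (ω : Site d → χ) :
    mass H h Λ (agree Λ Λ ω) = globalWeight H h Λ ω := by
  have agree_eq : agree Λ Λ ω = (({(fun v => ω v : Λ → χ)} : Finset (Λ → χ)) : Set (Λ → χ)) := by
    ext σ
    simp only [mem_agree, Finset.coe_singleton, Set.mem_singleton_iff, funext_iff]
    exact ⟨fun hσ v => hσ v v.2, fun hσ v _ => hσ v⟩
  rw [agree_eq, mass_coe_finset, Finset.sum_singleton, weight_restrict]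

end Mass

section Geometry

variable {d : ℕ} {χ : Type*}

theorem bdry_mono_left {D D' A : Set (Site d)} (hD : D ⊆ D') : bdry D A ⊆ bdry D' A :=
  fun _ ⟨hv, u, hu, huv⟩ => ⟨hv, u, hD hu, huv⟩

theorem subset_ball (X : Finset (Site d)) (r : ℕ) : X ⊆ ball X r :=
  fun v hv => mem_ball.2 ⟨v, hv, by simp [l1]⟩

theorem ssmEvent_eq_agree {Y : Set (Site d)} {η : Site d → χ} {X : Finset (Site d)} {r : ℕ}
    {τ : Site d → χ} (hτ : ∀ v ∈ Y, v ∈ ball X r → τ v = η v) :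
    ssmEvent X Y r η τ =
      agree (ball X r) (bdry Set.univ (ball X r) ∪ (Y ∩ ball X r)) τ := by
  ext σ
  refine ⟨fun hσ v hv => hv.elim (hσ.2 v) fun hvY => ?_, fun hσ => ⟨fun v hvY => ?_, ?_⟩⟩
  · exact (hσ.1 v hvY.1).trans (hτ v hvY.1 v.2).symm
  · exact (hσ v (Or.inr ⟨hvY, v.2⟩)).trans (hτ v hvY v.2)
  · exact agree_antitone _ τ Set.subset_union_left hσ

end Geometry

section Gibbs

variable {d : ℕ} {χ : Type*} {H : χ → χ → WithTop ℝ} {h : χ → ℝ} [Fintype χ] [MeasurableSpace χ]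
  {D Y : Set (Site d)} {η : Site d → χ} {ν : Measure (D → χ)}

theorem IsGibbs.eq_of_real_agree_ne_zero (hν : IsGibbs H h D Y η ν) {S : Set (Site d)}
    {τ : Site d → χ} (hτ : ν.real (agree D S τ) ≠ 0) {v : Site d} (hvD : v ∈ D) (hvS : v ∈ S)
    (hvY : v ∈ Y) : τ v = η v := by
  by_contra hne
  have null : ν (agree D S τ) = 0 := measure_mono_null (t := (agree D Y η)ᶜ) (fun σ hσ hσ' =>
    hne ((hσ ⟨v, hvD⟩ hvS).symm.trans (hσ' ⟨v, hvD⟩ hvY))) hν.fixed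
  exact hτ (by rw [measureReal_def, null, ENNReal.toReal_zero])

theorem IsGibbs.real_agree_eq_one (hν : IsGibbs H h D Y η ν) {S : Set (Site d)} {τ : Site d → χ}
    (hSY : S ⊆ Y) (hτ : ∀ v ∈ D, v ∈ S → τ v = η v) : ν.real (agree D S τ) = 1 := by
  have := hν.prob
  have ae_agree : agree D S η ∈ ae ν := mem_of_superset hν.fixed (agree_antitone D η hSY)
  rw [agree_congr hτ, measureReal_congr (eventuallyEq_univ.2 ae_agree), probReal_univ]

theorem IsGibbs.eq_of_finite {Λ : Finset (Site d)} {μ ν : Measure (↥(Λ : Set (Site d)) → χ)}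
    (hμ : IsGibbs H h Λ Y η μ) (hν : IsGibbs H h Λ Y η ν) : μ = ν := by
  have := hμ.prob
  have := hν.prob
  have bdry_self : bdry (Λ : Set (Site d)) Λ = ∅ :=
    Set.eq_empty_of_forall_notMem fun _ ⟨_, _, hu, _, hu'⟩ => hu' hu
  refine Measure.ext_of_singleton fun σ => ?_
  rw [← measureReal_eq_measureReal_iff, ← agree_extend (Λ : Set (Site d)) η σ,
    hμ.markov Λ subset_rfl, hν.markov Λ subset_rfl, bdry_self, Set.empty_union]
  congr 1
  by_cases hσ : ∀ v ∈ (Λ : Set (Site d)), v ∈ Y ∩ Λ → extend Λ η σ v = η v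
  · rw [hμ.real_agree_eq_one Set.inter_subset_left hσ,
      hν.real_agree_eq_one Set.inter_subset_left hσ]
  · push Not at hσ
    obtain ⟨v, hv, hvY, hne⟩ := hσ
    rw [of_not_not fun h0 => hne (hμ.eq_of_real_agree_ne_zero h0 hv hvY hvY.1),
      of_not_not fun h0 => hne (hν.eq_of_real_agree_ne_zero h0 hv hvY hvY.1)]

variable [MeasurableSingletonClass χ] {A : Finset (Site d)}

theorem IsGibbs.real_preimage_restrictTo (hν : IsGibbs H h D Y η ν) (hA : (A : Set (Site d)) ⊆ D)
    {τ : Site d → χ} {E : Set (A → χ)} (hE : E ⊆ agree A (bdry D A ∪ (Y ∩ A)) τ) :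
    ν.real (restrictTo hA ⁻¹' E) = mass H h A E *
      (ν.real (agree D (bdry D A ∪ (Y ∩ A)) τ) / mass H h A (agree A (bdry D A ∪ (Y ∩ A)) τ)) := by
  have := hν.prob
  lift E to Finset (A → χ) using Set.toFinite E
  have subset : bdry D A ∪ (Y ∩ A) ⊆ (A : Set (Site d)) :=
    Set.union_subset (fun v hv => hv.1) Set.inter_subset_right
  rw [← sum_measureReal_preimage_singleton (μ := ν) (f := restrictTo hA) E fun σ _ =>
    measurable_restrictTo hA (measurableSet_singleton σ), mass_coe_finset, Finset.sum_mul]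
  refine Finset.sum_congr rfl fun σ hσ => ?_
  have hτ (v : Site d) (hv : v ∈ bdry D A ∪ (Y ∩ A)) : extend A η σ v = τ v :=
    (extend_coe (A : Set (Site d)) η σ ⟨v, subset hv⟩).trans (hE hσ ⟨v, subset hv⟩ hv)
  rw [preimage_restrictTo_singleton hA η, hν.markov A hA, condProb,
    Set.inter_eq_left.2 (agree_antitone _ _ subset), mass_agree_self,
    ← weight_eq_globalWeight_extend, agree_congr (D := A) fun v _ => hτ v,
    agree_congr (D := D) fun v _ => hτ v, div_mul_eq_mul_div, mul_div_assoc]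

variable {S : Set (Site d)}

theorem IsGibbs.real_agree_inter_agree (hν : IsGibbs H h D Y η ν) (hA : (A : Set (Site d)) ⊆ D)
    (hS : bdry D A ∪ (Y ∩ A) ⊆ S) (hSA : S ⊆ A) {X : Set (Site d)} (hX : X ⊆ A)
    (ω τ : Site d → χ) :
    ν.real (agree D X ω ∩ agree D S τ) =
      condProb H h A (agree A X ω) (agree A S τ) * ν.real (agree D S τ) := by
  have hSτ : agree (A : Set (Site d)) S τ ⊆ agree A (bdry D A ∪ (Y ∩ A)) τ := agree_antitone _ _ hS
  rw [← preimage_restrictTo_agree hA hX, ← preimage_restrictTo_agree hA hSA, ← Set.preimage_inter,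
    hν.real_preimage_restrictTo hA (Set.inter_subset_right.trans hSτ),
    hν.real_preimage_restrictTo hA hSτ, ← mul_assoc, condProb_mul_mass]

theorem IsGibbs.mass_ne_zero (hν : IsGibbs H h D Y η ν) (hA : (A : Set (Site d)) ⊆ D)
    (hS : bdry D A ∪ (Y ∩ A) ⊆ S) (hSA : S ⊆ A) {τ : Site d → χ}
    (hτ : ν.real (agree D S τ) ≠ 0) : mass H h A (agree A S τ) ≠ 0 := by
  intro h0
  rw [← preimage_restrictTo_agree hA hSA,
    hν.real_preimage_restrictTo hA (agree_antitone _ _ hS), h0, zero_mul] at hτ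
  exact hτ rfl

theorem IsGibbs.real_agree_mem_convexHull (hν : IsGibbs H h D Y η ν) {S : Finset (Site d)}
    (hA : (A : Set (Site d)) ⊆ D) (hS : bdry D A ∪ (Y ∩ A) ⊆ S) (hSA : (S : Set (Site d)) ⊆ A)
    {X : Set (Site d)} (hX : X ⊆ A) (ω : Site d → χ) :
    ν.real (agree D X ω) ∈ convexHull ℝ ((fun τ => condProb H h A (agree A X ω) (agree A S τ)) ''
      {τ | (∀ v ∈ Y, v ∈ A → τ v = η v) ∧ mass H h A (agree A S τ) ≠ 0}) := by
  have := hν.prob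
  have hSD : (S : Set (Site d)) ⊆ D := hSA.trans hA
  have sum_fibers (E : Set (D → χ)) : ∑ b : S → χ with ν.real (agree D S (extend S η b)) ≠ 0,
      ν.real (E ∩ agree D S (extend S η b)) = ν.real E := by
    refine (Finset.sum_filter_of_ne fun b _ hb => mt (measureReal_mono_null
      Set.inter_subset_right) hb).trans ?_
    simp only [← preimage_restrictTo_singleton hSD η]
    exact sum_measureReal_inter_preimage_singleton ν (measurable_restrictTo hSD) E
  have sum_weights := sum_fibers Set.univ
  simp only [Set.univ_inter, probReal_univ] at sum_weights
  rw [← sum_fibers]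
  simp only [hν.real_agree_inter_agree hA hS hSA hX, mul_comm (condProb ..), ← smul_eq_mul]
  refine (convex_convexHull ℝ _).sum_mem (fun _ _ => measureReal_nonneg) sum_weights fun b hb => ?_
  refine subset_convexHull ℝ _ ⟨extend S η b, ⟨fun v hvY hvA => ?_, ?_⟩, rfl⟩
  · exact hν.eq_of_real_agree_ne_zero (Finset.mem_filter.1 hb).2 (hA hvA) (hS (Or.inr ⟨hvY, hvA⟩))
      hvY
  · exact hν.mass_ne_zero hA hS hSA (Finset.mem_filter.1 hb).2

/-- Both probabilities are averages of conditional probabilities given the spins on the boundary of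
`B_r(X)`. -/
theorem IsGibbs.abs_real_sub_le {D' : Set (Site d)} {ν' : Measure (D' → χ)}
    (hν : IsGibbs H h D Y η ν) (hν' : IsGibbs H h D' Y η ν') {X : Finset (Site d)} {R : ℕ → ℝ}
    (hR : IsSSMRate H h X Y R) {r : ℕ} (hr : 1 ≤ r) (hD : (ball X r : Set (Site d)) ⊆ D)
    (hD' : (ball X r : Set (Site d)) ⊆ D') (ω : Site d → χ) :
    |ν.real (agree D X ω) - ν'.real (agree D' X ω)| ≤ R r := by
  have subset_ball : bdry Set.univ (ball X r) ∪ (Y ∩ ball X r) ⊆ (ball X r : Set (Site d)) :=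
    Set.union_subset (fun v hv => hv.1) Set.inter_subset_right
  obtain ⟨S, hS⟩ : ∃ S : Finset (Site d), bdry Set.univ (ball X r) ∪ (Y ∩ ball X r) = S :=
    ((ball X r).finite_toSet.subset subset_ball).exists_finset_coe.imp fun _ => Eq.symm
  have bdry_subset (D : Set (Site d)) : bdry D (ball X r) ∪ (Y ∩ ball X r) ⊆ S :=
    hS ▸ Set.union_subset_union_left _ (bdry_mono_left (Set.subset_univ D))
  have hX : (X : Set (Site d)) ⊆ ball X r := SpinModel.subset_ball X r
  obtain ⟨_, ⟨τ, ⟨hτ, hτ0⟩, rfl⟩, _, ⟨τ', ⟨hτ', hτ0'⟩, rfl⟩, hdist⟩ := convexHull_exists_dist_ge2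
    (hν.real_agree_mem_convexHull hD (bdry_subset D) (hS ▸ subset_ball) hX ω)
    (hν'.real_agree_mem_convexHull hD' (bdry_subset D') (hS ▸ subset_ball) hX ω)
  rw [← Real.dist_eq]
  refine hdist.trans ?_
  have hssm := hR r hr ω η τ τ'
  rw [ssmEvent_eq_agree hτ, ssmEvent_eq_agree hτ', hS] at hssm
  exact hssm hτ0 hτ0'

theorem IsGibbs.eq_of_ssm (hSSM : SSM d H h) {μ ν : Measure (↥(Set.univ : Set (Site d)) → χ)}
    (hμ : IsGibbs H h Set.univ Y η μ) (hν : IsGibbs H h Set.univ Y η ν) : μ = ν := by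
  have := hμ.prob
  have := hν.prob
  have : Nonempty χ := ⟨η 0⟩
  refine ext_of_agree fun X _ ω => ?_
  obtain ⟨R, hR0, hR⟩ := hSSM X Y
  have hle : |μ.real (agree Set.univ X ω) - ν.real (agree Set.univ X ω)| ≤ 0 := by
    refine ge_of_tendsto hR0 ?_
    filter_upwards [eventually_ge_atTop 1] with r hr
    exact hμ.abs_real_sub_le hν hR hr (Set.subset_univ _) (Set.subset_univ _) ω
  exact sub_eq_zero.1 (abs_nonpos_iff.1 hle)

end Gibbs

theorem eventually_forall_le_of_pos {ι : Type*} [Finite ι] (f : ι → ℝ) :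
    ∀ᶠ c in 𝓝[>] 0, ∀ i, 0 < f i → c ≤ f i :=
  eventually_all.2 fun _ => eventually_imp_distrib_left.2 fun hi =>
    eventually_nhdsWithin_of_eventually_nhds (eventually_le_nhds hi)

section Positivity

variable {d : ℕ} {χ : Type*} {H : χ → χ → WithTop ℝ} {h : χ → ℝ}

theorem globalWeight_ne_zero_iff {Λ : Finset (Site d)} {σ : Site d → χ} :
    globalWeight H h Λ σ ≠ 0 ↔ ∀ p ∈ Λ ×ˢ Λ, pairFactor H σ p ≠ 0 := by
  have field_ne_zero : ∏ v ∈ Λ, Real.exp (-h (σ v)) ≠ 0 :=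
    Finset.prod_ne_zero_iff.2 fun v _ => (Real.exp_pos _).ne'
  rw [globalWeight, mul_ne_zero_iff_right field_ne_zero, Finset.prod_ne_zero_iff]

theorem pairFactor_update_ne_zero (hsymm : ∀ s t, H s t = H t s) {s : χ} (hs : ∀ t, H t s ≠ ⊤)
    {σ : Site d → χ} {p : Site d × Site d} (hp : pairFactor H σ p ≠ 0) (v : Site d) :
    pairFactor H (Function.update σ v s) p ≠ 0 := by
  unfold pairFactor at hp ⊢
  split_ifs at hp ⊢
  · by_cases h₁ : p.1 = v
    · rw [h₁, Function.update_self, hsymm]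
      exact (boltzmann_pos (hs _)).ne'
    · by_cases h₂ : p.2 = v
      · rw [h₂, Function.update_self]
        exact (boltzmann_pos (hs _)).ne'
      · rwa [Function.update_of_ne h₁, Function.update_of_ne h₂]
  · exact one_ne_zero

variable [Fintype χ]

theorem mass_ne_zero_iff {Λ : Finset (Site d)} {E : Set (Λ → χ)} :
    mass H h Λ E ≠ 0 ↔ ∃ σ ∈ E, weight H h Λ σ ≠ 0 := by
  rw [mass, Ne, Finset.sum_eq_zero_iff_of_nonneg fun σ _ =>
    Set.indicator_nonneg (fun _ _ => weight_nonneg H h Λ _) σ]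
  simp only [Finset.mem_univ, true_imp_iff, Set.indicator_apply_eq_zero, not_forall, exists_prop]

theorem condProb_pos_of_notMem (hsymm : ∀ s t, H s t = H t s) {s : χ} (hs : ∀ t, H t s ≠ ⊤)
    {A : Finset (Site d)} {S : Set (Site d)} {v : Site d} (hv : v ∉ S) {τ : Site d → χ}
    (hτ : mass H h A (agree A S τ) ≠ 0) :
    0 < condProb H h A (agree A {v} fun _ => s) (agree A S τ) := by
  refine (condProb_nonneg H h A _ _).lt_of_ne' (div_ne_zero ?_ hτ)
  obtain ⟨σ, hσ, hσ0⟩ := mass_ne_zero_iff.1 hτ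
  rw [weight_eq_globalWeight_extend H h A τ, globalWeight_ne_zero_iff] at hσ0
  refine mass_ne_zero_iff.2
    ⟨fun u => Function.update (extend A τ σ) v s u, ⟨?_, fun u hu => ?_⟩, ?_⟩
  · rintro u rfl
    exact Function.update_self _ _ _
  · have huv : (u : Site d) ≠ v := fun huv => hv (huv ▸ hu)
    exact (Function.update_of_ne huv _ _).trans ((extend_coe (A : Set (Site d)) τ σ u).trans
      (hσ u hu))
  · rw [weight_restrict, globalWeight_ne_zero_iff]
    exact fun p hp => pairFactor_update_ne_zero hsymm hs (hσ0 p hp) v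

variable [MeasurableSpace χ] [MeasurableSingletonClass χ]

/-- By the Markov property, only the finitely many conditional probabilities on the subgraphs of
`B_1(0)` matter. -/
theorem exists_pos_le_real_agree (hsymm : ∀ s t, H s t = H t s) {s : χ} (hs : ∀ t, H t s ≠ ⊤)
    {Y : Set (Site d)} (hY : 0 ∉ Y) (η : Site d → χ) :
    ∃ c > 0, ∀ D : Set (Site d), 0 ∈ D → ∀ ν : Measure (D → χ), IsGibbs H h D Y η ν →
      c ≤ ν.real (agree D {0} fun _ => s) := by
  classical
  let condProbZero (A : Finset (Site d)) (F : Set (A → χ)) : ℝ :=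
    condProb H h A (agree (A : Set (Site d)) {0} fun _ => s) F
  obtain ⟨c, hcond, hc⟩ := (((Filter.eventually_all_finset (ball {(0 : Site d)} 1).powerset).2
    fun A _ => eventually_forall_le_of_pos (condProbZero A)).and eventually_mem_nhdsWithin).exists
  refine ⟨c, hc, fun D hD ν hν => ?_⟩
  obtain ⟨A, hA⟩ : ∃ A, A = (ball {(0 : Site d)} 1).filter (· ∈ D) := ⟨_, rfl⟩
  have hAball : A ⊆ ball {(0 : Site d)} 1 := hA ▸ Finset.filter_subset _ _
  have hAD : (A : Set (Site d)) ⊆ D := by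
    rw [hA]
    exact fun v hv => (Finset.mem_filter.1 hv).2
  have zero_mem : (0 : Site d) ∈ A := hA ▸ Finset.mem_filter.2 ⟨subset_ball _ _ (by simp), hD⟩
  have zero_notMem : (0 : Site d) ∉ bdry D A ∪ (Y ∩ A) := by
    rintro (⟨-, u, huD, hu, huA⟩ | hY')
    · refine huA (hA ▸ Finset.mem_filter.2 ⟨mem_ball.2 ⟨0, by simp, ?_⟩, huD⟩)
      exact (adj_comm.1 hu).le
    · exact hY hY'.1
  have subset_erase : bdry D A ∪ (Y ∩ A) ⊆ (A.erase 0 : Finset (Site d)) := fun v hv =>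
    Finset.mem_coe.2 (Finset.mem_erase.2 ⟨fun h0 => zero_notMem (h0 ▸ hv),
      hv.elim (fun hv => hv.1) fun hv => hv.2⟩)
  refine convexHull_min ?_ (convex_Ici c) (hν.real_agree_mem_convexHull hAD subset_erase
    (Finset.coe_subset.2 (A.erase_subset 0)) (Set.singleton_subset_iff.2 zero_mem) _)
  rintro _ ⟨τ, ⟨-, hτ⟩, rfl⟩
  exact hcond A (Finset.mem_powerset.2 hAball) _
    (condProb_pos_of_notMem hsymm hs (Finset.notMem_erase 0 A) hτ)

end Positivity

section LocalLimits

variable {d : ℕ} {χ : Type*} {ι : Type*} {l : Filter ι} {D : Set (Site d)}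
  {D' : ι → Set (Site d)}

theorem eventually_bdry_eq (hD : ∀ u, ∀ᶠ m in l, (u ∈ D' m ↔ u ∈ D)) (A : Finset (Site d)) :
    ∀ᶠ m in l, bdry (D' m) A = bdry D A := by
  filter_upwards [(Filter.eventually_all_finset (ball A 1)).2 fun u _ => hD u] with m hm
  refine Set.ext fun v => and_congr_right fun hv => exists_congr fun u => ?_
  simp only [← and_assoc]
  refine and_congr_left fun _ => and_congr_left fun huv => hm u ?_
  exact mem_ball.2 ⟨v, hv, (adj_comm.1 huv).le⟩

theorem eventually_coe_subset (hD : ∀ u, ∀ᶠ m in l, (u ∈ D' m ↔ u ∈ D)) {X : Finset (Site d)}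
    (hX : (X : Set (Site d)) ⊆ D) : ∀ᶠ m in l, (X : Set (Site d)) ⊆ D' m :=
  ((Filter.eventually_all_finset X).2 fun u _ => hD u).mono fun _ hm u hu => (hm u hu).2 (hX hu)

/-- The configuration on `D` that equals `σ` where `σ` is defined and `η` elsewhere; it moves
measures between different graphs. -/
def transport {D' : Set (Site d)} (D : Set (Site d)) (η : Site d → χ) (σ : D' → χ) : D → χ :=
  fun v => extend D' η σ v

theorem preimage_transport_agree {D' X : Set (Site d)} (hX : X ⊆ D) (hX' : X ⊆ D')
    (η ω : Site d → χ) : transport D η ⁻¹' agree D X ω = agree D' X ω := by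
  refine Set.ext fun σ => ⟨fun hσ v hv => ?_, fun hσ v hv => ?_⟩
  · exact (extend_coe D' η σ v).symm.trans (hσ ⟨v, hX hv⟩ hv)
  · exact (extend_coe D' η σ ⟨v, hX' hv⟩).trans (hσ ⟨v, hX' hv⟩ hv)

theorem isClopen_agree [TopologicalSpace χ] [DiscreteTopology χ] (D : Set (Site d))
    (X : Finset (Site d)) (ω : Site d → χ) : IsClopen (agree D X ω) := by
  have agree_eq : agree D X ω =
      ⋂ v ∈ {v : D | (v : Site d) ∈ X}, (fun σ : D → χ => σ v) ⁻¹' {ω v} := by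
    ext σ
    simp only [mem_agree, Finset.mem_coe, Set.mem_ofPred_eq, Set.mem_iInter, Set.mem_preimage,
      Set.mem_singleton_iff]
  rw [agree_eq]
  exact (X.finite_toSet.preimage Subtype.val_injective.injOn).isClopen_biInter fun v _ =>
    (isClopen_discrete _).preimage (continuous_apply v)

variable [MeasurableSpace χ]

theorem measurable_transport {D' : Set (Site d)} (D : Set (Site d)) (η : Site d → χ) :
    Measurable (transport (D' := D') D η) := by
  refine measurable_pi_lambda _ fun v => ?_
  by_cases hv : (v : Site d) ∈ D'
  · simpa only [transport, extend_coe D' η _ ⟨v, hv⟩] using measurable_pi_apply _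
  · simpa only [transport, extend_of_notMem hv] using measurable_const

variable [MeasurableSingletonClass χ]

theorem measurableSet_agree [Finite χ] {X : Finset (Site d)} (hX : (X : Set (Site d)) ⊆ D)
    (ω : Site d → χ) : MeasurableSet (agree D X ω) := by
  rw [← preimage_restrictTo_agree hX subset_rfl]
  exact measurable_restrictTo hX (Set.toFinite (α := X → χ) _).measurableSet

theorem exists_tendsto_real_agree [Finite χ] (U : Ultrafilter ι) (P : ι → Measure (D → χ))
    (hP : ∀ m, IsProbabilityMeasure (P m)) :
    ∃ ν : Measure (D → χ), IsProbabilityMeasure ν ∧ ∀ (X : Finset (Site d)) (ω : Site d → χ),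
      Tendsto (fun m => (P m).real (agree D X ω)) U (𝓝 (ν.real (agree D X ω))) := by
  let _ : TopologicalSpace χ := ⊥
  have : DiscreteTopology χ := ⟨rfl⟩
  have : BorelSpace χ := ⟨by
    rw [borel_eq_top_of_discrete]
    exact top_le_iff.1 fun s _ => (Set.toFinite s).measurableSet⟩
  let P' (m : ι) : ProbabilityMeasure (D → χ) := ⟨P m, hP m⟩
  refine ⟨(U.map P').lim, inferInstance, fun X ω => ?_⟩
  exact (ENNReal.tendsto_toReal (measure_ne_top _ _)).comp <|
    ProbabilityMeasure.tendsto_measure_of_null_frontier_of_tendsto' (U.map P').le_nhds_lim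
      (by rw [(isClopen_agree D X ω).frontier_eq, measure_empty])

variable [Fintype χ] {H : χ → χ → WithTop ℝ} {h : χ → ℝ} {Y : Set (Site d)} {η : Site d → χ}
  {ν' : ∀ m, Measure (D' m → χ)}

theorem IsGibbs.of_tendsto [l.NeBot] (hν' : ∀ m, IsGibbs H h (D' m) Y η (ν' m))
    (hD : ∀ u, ∀ᶠ m in l, (u ∈ D' m ↔ u ∈ D)) {ν : Measure (D → χ)} (hν : IsProbabilityMeasure ν)
    (hlim : ∀ X : Finset (Site d), (X : Set (Site d)) ⊆ D → ∀ ω : Site d → χ,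
      Tendsto (fun m => (ν' m).real (agree (D' m) X ω)) l (𝓝 (ν.real (agree D X ω)))) :
    IsGibbs H h D Y η ν where
  prob := hν
  fixed := by
    refine ae_all_iff.2 fun v => ?_
    by_cases hv : (v : Site d) ∈ Y
    · have singleton_subset : (({(v : Site d)} : Finset (Site d)) : Set (Site d)) ⊆ D := by simp
      have real_eq_one : ν.real (agree D ({(v : Site d)} : Finset (Site d)) η) = 1 :=
        tendsto_nhds_unique (hlim _ singleton_subset η) (tendsto_const_nhds.congr fun m =>
          ((hν' m).real_agree_eq_one (by simpa using hv) fun _ _ _ => rfl).symm)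
      have ae_agree := (mem_ae_iff_prob_eq_one (measurableSet_agree singleton_subset η)).2
        ((ENNReal.toReal_eq_one_iff _).1 real_eq_one)
      filter_upwards [ae_agree] with σ hσ _
      exact hσ v (by simp)
    · exact ae_of_all _ fun _ hvY => absurd hvY hv
  markov A hA ω := by
    have subset : bdry D A ∪ (Y ∩ A) ⊆ A :=
      Set.union_subset (fun v hv => hv.1) Set.inter_subset_right
    refine tendsto_nhds_unique (hlim A hA ω) ?_
    have tendsto_bdry := hlim (A.finite_toSet.subset subset).toFinset
      (by rw [Set.Finite.coe_toFinset]; exact subset.trans hA) ω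
    rw [Set.Finite.coe_toFinset] at tendsto_bdry
    refine (tendsto_bdry.const_mul _).congr' ?_
    filter_upwards [eventually_bdry_eq hD A, eventually_coe_subset hD hA] with m hbdry hAm
    rw [(hν' m).markov A hAm ω, hbdry]

theorem exists_isGibbs_tendsto (U : Ultrafilter ι) (hν' : ∀ m, IsGibbs H h (D' m) Y η (ν' m))
    (hD : ∀ u, ∀ᶠ m in U, (u ∈ D' m ↔ u ∈ D)) :
    ∃ ν : Measure (D → χ), IsGibbs H h D Y η ν ∧
      ∀ X : Finset (Site d), (X : Set (Site d)) ⊆ D → ∀ ω : Site d → χ,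
        Tendsto (fun m => (ν' m).real (agree (D' m) X ω)) U (𝓝 (ν.real (agree D X ω))) := by
  have hprob (m : ι) := (hν' m).prob
  obtain ⟨ν, hν, hlim⟩ := exists_tendsto_real_agree U
    (fun m => (ν' m).map (transport D η)) fun m =>
      Measure.isProbabilityMeasure_map (measurable_transport D η).aemeasurable
  have hlim' (X : Finset (Site d)) (hX : (X : Set (Site d)) ⊆ D) (ω : Site d → χ) :
      Tendsto (fun m => (ν' m).real (agree (D' m) X ω)) U (𝓝 (ν.real (agree D X ω))) := by
    refine (hlim X ω).congr' ?_
    filter_upwards [eventually_coe_subset hD hX] with m hm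
    rw [map_measureReal_apply (measurable_transport D η) (measurableSet_agree hX ω),
      preimage_transport_agree hX hm]
  exact ⟨ν, .of_tendsto hν' hD hν hlim', hlim'⟩

theorem IsGibbs.tendsto_real_agree (hν' : ∀ m, IsGibbs H h (D' m) Y η (ν' m))
    (hD : ∀ u, ∀ᶠ m in l, (u ∈ D' m ↔ u ∈ D)) {μ : Measure (D → χ)}
    (hμ : ∀ ν, IsGibbs H h D Y η ν → ν = μ) {X : Finset (Site d)} (hX : (X : Set (Site d)) ⊆ D)
    (ω : Site d → χ) :
    Tendsto (fun m => (ν' m).real (agree (D' m) X ω)) l (𝓝 (μ.real (agree D X ω))) := by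
  refine tendsto_iff_ultrafilter _ _ _ |>.2 fun U hU => ?_
  obtain ⟨ν, hν, hlim⟩ := exists_isGibbs_tendsto U hν' fun u => hU (hD u)
  rw [← hμ ν hν]
  exact hlim X hX ω

end LocalLimits

section Lattice

variable {d : ℕ}

theorem lexLT_iff_toColex_lt {u v : Site d} : LexLT u v ↔ toColex u < toColex v :=
  exists_congr fun _ => and_comm

instance : IsStrictTotalOrder (Site d) LexLT where
  trichotomous u v huv hvu := by
    rw [lexLT_iff_toColex_lt] at huv hvu
    exact toColex.injective (le_antisymm (not_lt.1 hvu) (not_lt.1 huv))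
  irrefl u hu := lt_irrefl _ (lexLT_iff_toColex_lt.1 hu)
  trans u v w huv hvw := lexLT_iff_toColex_lt.2
    ((lexLT_iff_toColex_lt.1 huv).trans (lexLT_iff_toColex_lt.1 hvw))

theorem sum_inter_sub_inter {α : Type*} (r : α → α → Prop) [IsStrictTotalOrder α r]
    (F : Set α → ℝ) (Λ : Finset α) :
    ∑ v ∈ Λ, (F (Λ ∩ {u | r v u}) - F (Λ ∩ {u | u = v ∨ r v u})) = F ∅ - F Λ := by
  classical
  let _ : LinearOrder α := linearOrderOfSTO r
  induction Λ using Finset.induction_on_min with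
  | empty => rw [Finset.sum_empty, Finset.coe_empty, sub_self]
  | insert a Λ ha ih =>
    have ha : (Λ : Set α) ⊆ {u | r a u} := ha
    have notMem_lt (v : α) (hv : v ∈ Λ) : a ∉ {u | r v u} := asymm (ha hv)
    have notMem_le (v : α) (hv : v ∈ Λ) : a ∉ {u | u = v ∨ r v u} :=
      not_or.2 ⟨ne_of_irrefl (ha hv), notMem_lt v hv⟩
    have insert_inter_lt : insert a (Λ : Set α) ∩ {u | r a u} = Λ := by
      rw [Set.insert_inter_of_notMem (t := {u | r a u}) (irrefl a), Set.inter_eq_left.2 ha]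
    have insert_inter_le : insert a (Λ : Set α) ∩ {u | u = a ∨ r a u} = insert a (Λ : Set α) :=
      Set.inter_eq_left.2 fun u hu => Or.imp_right (fun hu => ha hu) hu
    rw [Finset.sum_insert fun haΛ => irrefl a (ha haΛ), Finset.coe_insert, insert_inter_lt,
      insert_inter_le, Finset.sum_congr rfl fun v hv => by
        rw [Set.insert_inter_of_notMem (notMem_lt v hv),
          Set.insert_inter_of_notMem (notMem_le v hv)], ih]
    ring

/-- The translate of `Λ` that moves `v` to the origin. -/
def shift (Λ : Finset (Site d)) (v : Site d) : Finset (Site d) :=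
  Λ.map (Equiv.subRight v).toEmbedding

theorem mem_shift {Λ : Finset (Site d)} {u v : Site d} : u ∈ shift Λ v ↔ u + v ∈ Λ :=
  Finset.mem_map_equiv

theorem adj_sub_right {u v w : Site d} : Adj (u - w) (v - w) ↔ Adj u v := by
  simp only [Adj, l1, Pi.sub_apply, sub_sub_sub_cancel_right]

theorem lexLT_sub_right {u v w : Site d} : LexLT (u - w) (v - w) ↔ LexLT u v := by
  simp only [LexLT, Pi.sub_apply, sub_lt_sub_iff_right, sub_left_inj]

theorem adj_and_lexLT_iff {u v : Site d} :
    Adj u v ∧ LexLT u v ↔ ∃ j, v = u + Pi.single j 1 := by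
  constructor
  · rintro ⟨hadj, k, hk, -⟩
    rw [Adj, l1, ← Finset.add_sum_erase _ _ (Finset.mem_univ k)] at hadj
    have sum_erase : ∑ i ∈ Finset.univ.erase k, (u i - v i).natAbs = 0 := by omega
    rw [Finset.sum_eq_zero_iff] at sum_erase
    refine ⟨k, funext fun i => ?_⟩
    obtain rfl | hi := eq_or_ne i k
    · rw [Pi.add_apply, Pi.single_eq_same]
      omega
    · have := sum_erase i (Finset.mem_erase.2 ⟨hi, Finset.mem_univ i⟩)
      rw [Pi.add_apply, Pi.single_eq_of_ne hi]
      omega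
  · rintro ⟨j, rfl⟩
    refine ⟨?_, j, by simp, fun i hi => by simp [hi.ne']⟩
    rw [Adj, l1, Finset.sum_eq_single j (fun i _ hi => by simp [hi]) (by simp)]
    simp

open scoped Classical in
/-- The edges of the graph induced by `Λ`, listed in increasing lexicographic order. -/
def edges (Λ : Finset (Site d)) : Finset (Site d × Site d) :=
  {p ∈ Λ ×ˢ Λ | Adj p.1 p.2 ∧ LexLT p.1 p.2}

/-- The sites of `Λ` whose neighbour in the positive `j`-th direction lies outside `Λ`. -/
def upperBdry (Λ : Finset (Site d)) (j : Fin d) : Finset (Site d) :=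
  {v ∈ Λ | v + Pi.single j 1 ∉ Λ}

theorem card_edges (Λ : Finset (Site d)) :
    (edges Λ).card = ∑ j, ({v ∈ Λ | v + Pi.single j 1 ∈ Λ} : Finset (Site d)).card := by
  classical
  rw [← Finset.card_sigma]
  refine (Finset.card_bij (fun q _ => (q.2, q.2 + Pi.single q.1 1)) ?_ ?_ ?_).symm
  · rintro ⟨j, v⟩ hq
    simp only [Finset.mem_sigma, Finset.mem_univ, true_and, Finset.mem_filter] at hq
    exact Finset.mem_filter.2 ⟨Finset.mem_product.2 hq, adj_and_lexLT_iff.2 ⟨j, rfl⟩⟩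
  · rintro ⟨j, v⟩ - ⟨i, w⟩ - heq
    obtain ⟨rfl, hvw⟩ := Prod.mk.inj heq
    have single_eq : (Pi.single j 1 : Site d) = Pi.single i 1 := add_left_cancel hvw
    by_contra hne
    have hij : j ≠ i := fun hij => hne (hij ▸ rfl)
    simpa [hij] using congrFun single_eq j
  · rintro ⟨u, v⟩ hp
    obtain ⟨huv, hlt⟩ := Finset.mem_filter.1 hp
    obtain ⟨j, rfl : v = u + Pi.single j 1⟩ := adj_and_lexLT_iff.1 hlt
    exact ⟨⟨j, u⟩, by simpa using Finset.mem_product.1 huv, rfl⟩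

theorem card_edges_add_sum_card_upperBdry (Λ : Finset (Site d)) :
    (edges Λ).card + ∑ j, (upperBdry Λ j).card = d * Λ.card := by
  simp only [card_edges, upperBdry, ← Finset.sum_add_distrib,
    Finset.card_filter_add_card_filter_not, Finset.sum_const, Finset.card_univ, Fintype.card_fin,
    smul_eq_mul]

end Lattice

section LogPartition

variable {d : ℕ} {χ : Type*} (H : χ → χ → WithTop ℝ) (h : χ → ℝ)

theorem globalWeight_const {s : χ} {x : ℝ} (hx : H s s = x) (Λ : Finset (Site d)) :
    globalWeight H h Λ (fun _ => s) = Real.exp (-((edges Λ).card * x) - Λ.card * h s) := by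
  classical
  unfold globalWeight pairFactor
  rw [← Finset.prod_filter, Finset.prod_const, Finset.prod_const, hx, boltzmann_coe,
    ← Real.exp_nat_mul, ← Real.exp_nat_mul, ← Real.exp_add, edges]
  congr 1
  ring

theorem globalWeight_shift (Λ : Finset (Site d)) (v : Site d) (σ : Site d → χ) :
    globalWeight H h (shift Λ v) σ = globalWeight H h Λ fun u => σ (u - v) := by
  classical
  simp only [globalWeight, Finset.prod_product, shift, Finset.prod_map]
  refine congrArg₂ _ (Finset.prod_congr rfl fun u _ => Finset.prod_congr rfl fun w _ => ?_) rfl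
  exact if_congr (and_congr adj_sub_right lexLT_sub_right) rfl rfl

variable [Fintype χ]

theorem mass_agree_shift (Λ : Finset (Site d)) (v : Site d) (T : Set (Site d)) (τ : Site d → χ) :
    mass H h (shift Λ v) (agree (shift Λ v) T τ) =
      mass H h Λ (agree Λ {u | u - v ∈ T} fun u => τ (u - v)) := by
  classical
  let e : shift Λ v ≃ Λ := (Equiv.addRight v).subtypeEquiv fun _ => mem_shift
  refine Fintype.sum_equiv (e.arrowCongr (Equiv.refl χ)) _ _ fun σ => ?_
  have weight_eq : weight H h (shift Λ v) σ = weight H h Λ (e.arrowCongr (Equiv.refl χ) σ) := by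
    rw [weight_eq_globalWeight_extend H h _ τ, globalWeight_shift, ← weight_restrict]
    exact congrArg _ (funext fun u => extend_coe (shift Λ v : Set (Site d)) τ σ (e.symm u))
  simp only [Set.indicator_apply]
  refine if_congr ⟨fun hσ u hu => hσ (e.symm u) hu, fun hσ u hu => ?_⟩ weight_eq rfl
  have coe_sub (u : shift Λ v) : (e u : Site d) - v = u := add_sub_cancel_right _ _
  have hσu := hσ (e u) (by rwa [Set.mem_ofPred_eq, coe_sub])
  simpa only [Equiv.arrowCongr_apply, Function.comp_apply, e.symm_apply_apply,
    Equiv.refl_apply, coe_sub] using hσu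

/-- The probability that the spin at the origin is `s`, given that the lexicographically later spins
are `s`, in the finite volume `Λ`. -/
def cavityProb (s : χ) (Λ : Finset (Site d)) : ℝ :=
  condProb H h Λ (agree (Λ : Set (Site d)) {0} fun _ => s)
    (agree (Λ : Set (Site d)) {u | LexLT 0 u} fun _ => s)

variable {H h}

theorem mass_agree_const_ne_zero {s : χ} (hs : H s s ≠ ⊤) (Λ : Finset (Site d))
    (T : Set (Site d)) : mass H h Λ (agree Λ T fun _ => s) ≠ 0 := by
  lift H s s to ℝ using hs with x hx
  refine mass_ne_zero_iff.2 ⟨fun _ => s, fun _ _ => rfl, ?_⟩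
  rw [weight_restrict H h Λ fun _ => s, globalWeight_const H h hx.symm]
  exact (Real.exp_pos _).ne'

theorem cavityProb_shift (s : χ) (Λ : Finset (Site d)) (v : Site d) :
    cavityProb H h s (shift Λ v) = mass H h Λ (agree Λ {u | u = v ∨ LexLT v u} fun _ => s) /
      mass H h Λ (agree Λ {u | LexLT v u} fun _ => s) := by
  have agree_inter : agree (shift Λ v : Set (Site d)) {0} (fun _ => s) ∩
      agree (shift Λ v : Set (Site d)) {u | LexLT 0 u} (fun _ => s) =
      agree (shift Λ v : Set (Site d)) {u | u = 0 ∨ LexLT 0 u} fun _ => s :=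
    Set.ext fun σ => ⟨fun hσ u hu => hu.elim (hσ.1 u) (hσ.2 u),
      fun hσ => ⟨fun u hu => hσ u (Or.inl hu), fun u hu => hσ u (Or.inr hu)⟩⟩
  have lexLT_zero_sub (u : Site d) : LexLT 0 (u - v) ↔ LexLT v u := by
    rw [← lexLT_sub_right (u := v) (w := v), sub_self]
  rw [cavityProb, condProb, agree_inter, mass_agree_shift, mass_agree_shift]
  simp only [Set.mem_ofPred_eq, lexLT_zero_sub, sub_eq_zero]

theorem log_cavityProb_shift {s : χ} (hs : H s s ≠ ⊤) (Λ : Finset (Site d)) (v : Site d) :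
    Real.log (cavityProb H h s (shift Λ v)) =
      Real.log (mass H h Λ (agree Λ {u | u = v ∨ LexLT v u} fun _ => s)) -
        Real.log (mass H h Λ (agree Λ {u | LexLT v u} fun _ => s)) := by
  rw [cavityProb_shift, Real.log_div (mass_agree_const_ne_zero hs Λ _)
    (mass_agree_const_ne_zero hs Λ _)]

theorem log_partitionFn {s : χ} {x : ℝ} (hx : H s s = x) (Λ : Finset (Site d)) :
    Real.log (partitionFn H h Λ) = -((edges Λ).card * x) - Λ.card * h s -
      ∑ v ∈ Λ, Real.log (cavityProb H h s (shift Λ v)) := by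
  have telescope := sum_inter_sub_inter LexLT
    (fun T => Real.log (mass H h Λ (agree Λ T fun _ => s))) Λ
  have agree_inter (T : Set (Site d)) : agree (Λ : Set (Site d)) (Λ ∩ T) (fun _ => s) =
      agree (Λ : Set (Site d)) T fun _ => s :=
    Set.ext fun σ => forall_congr' fun u => by simp only [Set.mem_inter_iff, u.2, true_and]
  have agree_empty : agree (Λ : Set (Site d)) ∅ (fun _ => s) = Set.univ :=
    Set.eq_univ_of_forall fun _ _ hv => hv.elim
  have mass_univ : mass H h Λ Set.univ = partitionFn H h Λ := by
    simp only [mass, Set.indicator_univ, partitionFn]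
  simp only [agree_inter, agree_empty] at telescope
  rw [mass_univ, mass_agree_self, globalWeight_const H h hx, Real.log_exp,
    Finset.sum_sub_distrib] at telescope
  simp only [log_cavityProb_shift (hx ▸ WithTop.coe_ne_top), Finset.sum_sub_distrib]
  linarith

theorem log_partitionFn_sub {s : χ} {x : ℝ} (hx : H s s = x) (p : ℝ) (Λ : Finset (Site d)) :
    Real.log (partitionFn H h Λ) - Λ.card * (-Real.log p - d * x - h s) =
      x * ∑ j, ((upperBdry Λ j).card : ℝ) +
        ∑ v ∈ Λ, (Real.log p - Real.log (cavityProb H h s (shift Λ v))) := by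
  have card_edges : ((edges Λ).card : ℝ) + ∑ j, ((upperBdry Λ j).card : ℝ) = d * Λ.card := by
    exact_mod_cast card_edges_add_sum_card_upperBdry Λ
  rw [log_partitionFn hx, Finset.sum_sub_distrib, Finset.sum_const, nsmul_eq_mul]
  linear_combination -x * card_edges

end LogPartition

theorem abs_log_sub_log_le {a b c : ℝ} (hc : 0 < c) (ha : c ≤ a) (hb : c ≤ b) :
    |Real.log a - Real.log b| ≤ |a - b| / c := by
  wlog hab : b ≤ a generalizing a b
  · rw [abs_sub_comm, abs_sub_comm a]
    exact this hb ha (le_of_not_ge hab)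
  have hb0 : 0 < b := hc.trans_le hb
  have ha0 : 0 < a := hc.trans_le ha
  rw [abs_of_nonneg (sub_nonneg.2 (Real.log_le_log hb0 hab)), abs_of_nonneg (sub_nonneg.2 hab)]
  calc Real.log a - Real.log b = Real.log (a / b) := (Real.log_div ha0.ne' hb0.ne').symm
    _ ≤ a / b - 1 := Real.log_le_sub_one_of_pos (div_pos ha0 hb0)
    _ = (a - b) / b := by rw [sub_div, div_self hb0.ne']
    _ ≤ (a - b) / c := div_le_div_of_nonneg_left (sub_nonneg.2 hab) hc hb

section CavityMarginal

variable {d : ℕ} {χ : Type*} {H : χ → χ → WithTop ℝ} {h : χ → ℝ} [Fintype χ] [MeasurableSpace χ]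
  {s : χ} {D D' : Set (Site d)} {p p' : ℝ}

theorem IsCavityMarginal.nonneg (hp : IsCavityMarginal H h D s p) : 0 ≤ p := by
  obtain ⟨μ, -, rfl⟩ := hp
  exact measureReal_nonneg

theorem IsCavityMarginal.le_one (hp : IsCavityMarginal H h D s p) : p ≤ 1 := by
  obtain ⟨μ, hμ, rfl⟩ := hp
  have := ((hμ μ).2 rfl).prob
  exact measureReal_le_one

theorem IsCavityMarginal.abs_sub_le_one (hp : IsCavityMarginal H h D s p)
    (hp' : IsCavityMarginal H h D' s p') : |p - p'| ≤ 1 :=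
  abs_sub_le_of_nonneg_of_le hp.nonneg hp.le_one hp'.nonneg hp'.le_one

variable [MeasurableSingletonClass χ]

theorem isCavityMarginal_cavityProb (hs : H s s ≠ ⊤) (Λ : Finset (Site d)) :
    IsCavityMarginal H h (Λ : Set (Site d)) s (cavityProb H h s Λ) := by
  have hgibbs := isGibbs_finiteGibbs H h (mass_agree_const_ne_zero (h := h) hs Λ {u | LexLT 0 u})
  exact ⟨_, fun ν => ⟨fun hν => hν.eq_of_finite hgibbs, fun hν => hν ▸ hgibbs⟩,
    finiteGibbs_real ..⟩

theorem exists_isCavityMarginal_univ (hs : H s s ≠ ⊤) (hSSM : SSM d H h) :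
    ∃ p, IsCavityMarginal H h (Set.univ : Set (Site d)) s p := by
  obtain ⟨μ, hμ, -⟩ := exists_isGibbs_tendsto (D := Set.univ) (hyperfilter ℕ)
    (fun m => isGibbs_finiteGibbs H h
      (mass_agree_const_ne_zero (h := h) hs (ball {(0 : Site d)} m) {u | LexLT 0 u}))
    fun u => Nat.hyperfilter_le_atTop ((eventually_ge_atTop (l1 u 0)).mono fun m hm =>
      iff_of_true (Finset.mem_coe.2 (mem_ball.2 ⟨0, Finset.mem_singleton_self 0, hm⟩)) trivial)
  exact ⟨_, μ, fun ν => ⟨fun hν => hν.eq_of_ssm hSSM hμ, fun hν => hν ▸ hμ⟩, rfl⟩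

theorem exists_pos_le_of_isCavityMarginal (hsymm : ∀ s t, H s t = H t s) (hs : ∀ t, H t s ≠ ⊤) :
    ∃ c > 0, ∀ D : Set (Site d), 0 ∈ D → ∀ p, IsCavityMarginal H h D s p → c ≤ p := by
  obtain ⟨c, hc, hle⟩ := exists_pos_le_real_agree (h := h) hsymm hs (Y := {u : Site d | LexLT 0 u})
    (irrefl (r := LexLT) (0 : Site d)) fun _ => s
  refine ⟨c, hc, fun D hD p hp => ?_⟩
  obtain ⟨μ, hμ, rfl⟩ := hp
  exact hle D hD μ ((hμ μ).2 rfl)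

theorem IsCavityMarginal.pos (hp : IsCavityMarginal H h D s p) (hsymm : ∀ s t, H s t = H t s)
    (hs : ∀ t, H t s ≠ ⊤) (hD : 0 ∈ D) : 0 < p := by
  obtain ⟨c, hc, hle⟩ := exists_pos_le_of_isCavityMarginal (d := d) (h := h) hsymm hs
  exact hc.trans_le (hle D hD p hp)

theorem exists_abs_log_sub_le_mul (hsymm : ∀ s t, H s t = H t s) (hs : ∀ t, H t s ≠ ⊤) :
    ∃ C ≥ 0, ∀ D D' : Set (Site d), 0 ∈ D → 0 ∈ D' → ∀ p p', IsCavityMarginal H h D s p →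
      IsCavityMarginal H h D' s p' → |Real.log p - Real.log p'| ≤ C * |p - p'| := by
  obtain ⟨c, hc, hle⟩ := exists_pos_le_of_isCavityMarginal (d := d) (h := h) hsymm hs
  refine ⟨c⁻¹, (inv_pos.2 hc).le, fun D D' hD hD' p p' hp hp' => ?_⟩
  rw [← div_eq_inv_mul]
  exact abs_log_sub_log_le hc (hle D hD p hp) (hle D' hD' p' hp')

theorem IsCavityMarginal.abs_sub_le (hp : IsCavityMarginal H h D s p)
    (hp' : IsCavityMarginal H h D' s p') {R : ℕ → ℝ}
    (hR : IsSSMRate H h {(0 : Site d)} {u | LexLT 0 u} R) {r : ℕ} (hr : 1 ≤ r)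
    (hD : (ball {(0 : Site d)} r : Set (Site d)) ⊆ D)
    (hD' : (ball {(0 : Site d)} r : Set (Site d)) ⊆ D') : |p - p'| ≤ R r := by
  obtain ⟨μ, hμ, rfl⟩ := hp
  obtain ⟨μ', hμ', rfl⟩ := hp'
  simpa only [Finset.coe_singleton] using
    ((hμ μ).2 rfl).abs_real_sub_le ((hμ' μ').2 rfl) hR hr hD hD' fun _ => s

theorem exists_abs_log_sub_le_geometric (hsymm : ∀ s t, H s t = H t s) (hs : ∀ t, H t s ≠ ⊤)
    (hExp : ExpSSM d H h) :
    ∃ C, ∃ θ ∈ Set.Ioo (0 : ℝ) 1, ∀ (m : ℕ) (D D' : Set (Site d)),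
      (ball {(0 : Site d)} m : Set (Site d)) ⊆ D → (ball {(0 : Site d)} m : Set (Site d)) ⊆ D' →
        ∀ p p', IsCavityMarginal H h D s p → IsCavityMarginal H h D' s p' →
          |Real.log p - Real.log p'| ≤ C * θ ^ m := by
  obtain ⟨C, hC, hlip⟩ := exists_abs_log_sub_le_mul (d := d) (h := h) hsymm hs
  obtain ⟨κ, γ, hκ, hγ, hR⟩ := hExp {0} {u | LexLT 0 u}
  refine ⟨C * (κ + 1), Real.exp (-γ), ⟨Real.exp_pos _, Real.exp_lt_one_iff.2 (neg_neg_of_pos hγ)⟩,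
    fun m D D' hD hD' p p' hp hp' => ?_⟩
  have zero_mem_ball : (0 : Site d) ∈ (ball {(0 : Site d)} m : Set (Site d)) :=
    Finset.mem_coe.2 (subset_ball _ _ (Finset.mem_singleton_self 0))
  refine (hlip D D' (hD zero_mem_ball) (hD' zero_mem_ball) p p' hp hp').trans ?_
  rw [mul_assoc]
  refine mul_le_mul_of_nonneg_left ?_ hC
  obtain rfl | hm := Nat.eq_zero_or_pos m
  · rw [pow_zero, mul_one]
    exact (hp.abs_sub_le_one hp').trans (le_add_of_nonneg_left hκ.le)
  · have abs_sub_le := hp.abs_sub_le hp' hR hm hD hD'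
    rw [mul_comm (-γ), Real.exp_nat_mul] at abs_sub_le
    exact abs_sub_le.trans (mul_le_mul_of_nonneg_right (le_add_of_nonneg_right zero_le_one)
      (pow_nonneg (Real.exp_pos _).le m))

theorem IsCavityMarginal.tendsto {ι : Type*} {l : Filter ι} {D' : ι → Set (Site d)} {p' : ι → ℝ}
    (hp : IsCavityMarginal H h D s p) (h0 : 0 ∈ D)
    (hp' : ∀ m, IsCavityMarginal H h (D' m) s (p' m)) (hD : ∀ u, ∀ᶠ m in l, (u ∈ D' m ↔ u ∈ D)) :
    Tendsto p' l (𝓝 p) := by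
  obtain ⟨μ, hμ, rfl⟩ := hp
  choose μ' hμ' hp' using hp'
  obtain rfl := funext hp'
  simpa only [Finset.coe_singleton] using IsGibbs.tendsto_real_agree
    (fun m => (hμ' m (μ' m)).2 rfl) hD (fun ν => (hμ ν).1) (X := {0})
    (by rwa [Finset.coe_singleton, Set.singleton_subset_iff]) fun _ => s

theorem IsCavityMarginal.exists_abs_log_sub_lt
    (hp : IsCavityMarginal H h (Set.univ : Set (Site d)) s p) (hp0 : p ≠ 0) {ε : ℝ} (hε : 0 < ε) :
    ∃ M : ℕ, ∀ (D' : Set (Site d)) (p' : ℝ), (ball {(0 : Site d)} M : Set (Site d)) ⊆ D' →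
      IsCavityMarginal H h D' s p' → |Real.log p - Real.log p'| < ε := by
  by_contra! hcon
  choose D' p' hD hp' hle using hcon
  have hlim := (hp.tendsto trivial hp' fun u => (eventually_ge_atTop (l1 u 0)).mono fun m hm =>
    iff_of_true (hD m (mem_ball.2 ⟨0, Finset.mem_singleton_self 0, hm⟩)) trivial).log hp0
  obtain ⟨m, hm⟩ := (Metric.tendsto_nhds.1 hlim ε hε).exists
  rw [Real.dist_eq, abs_sub_comm] at hm
  exact (hle m).not_gt hm

end CavityMarginal

theorem abs_sum_le_mul_card_add_mul_card_filter {ι : Type*} {t : Finset ι} {P : ι → Prop}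
    [DecidablePred P] {f : ι → ℝ} {ε K : ℝ} (hε : 0 ≤ ε) (hP : ∀ i ∈ t, P i → |f i| ≤ K)
    (hnotP : ∀ i ∈ t, ¬P i → |f i| ≤ ε) :
    |∑ i ∈ t, f i| ≤ ε * t.card + K * (t.filter P).card := by
  have term_le : ∀ i ∈ t, |f i| ≤ ε + if P i then K else 0 := fun i hi => by
    split_ifs with hPi
    · exact (hP i hi hPi).trans (le_add_of_nonneg_left hε)
    · exact (hnotP i hi hPi).trans_eq (add_zero ε).symm
  calc |∑ i ∈ t, f i| ≤ ∑ i ∈ t, (ε + if P i then K else 0) :=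
        (Finset.abs_sum_le_sum_abs _ _).trans (Finset.sum_le_sum term_le)
    _ = ε * t.card + K * (t.filter P).card := by
        rw [Finset.sum_add_distrib, ← Finset.sum_filter, Finset.sum_const, Finset.sum_const,
          nsmul_eq_mul, nsmul_eq_mul, mul_comm, mul_comm K]

section FreeEnergy

variable {d : ℕ}

theorem l1_triangle (u v w : Site d) : l1 u w ≤ l1 u v + l1 v w := by
  rw [l1, l1, l1, ← Finset.sum_add_distrib]
  exact Finset.sum_le_sum fun i _ => by omega

theorem card_ball_le (X : Finset (Site d)) (r : ℕ) :
    (ball X r).card ≤ X.card * (2 * r + 1) ^ d := by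
  refine Finset.card_biUnion_le_card_mul _ _ _ fun v _ => (Finset.card_filter_le _ _).trans ?_
  rw [Pi.card_Icc]
  calc ∏ i, (Finset.Icc (v i - (r : ℤ)) (v i + r)).card ≤ ∏ _i : Fin d, (2 * r + 1) :=
        Finset.prod_le_prod' fun i _ => by rw [Int.card_Icc]; omega
    _ = (2 * r + 1) ^ d := by rw [Finset.prod_const, Finset.card_univ, Fintype.card_fin]

theorem exists_adj_l1_lt {u v : Site d} (huv : u ≠ v) : ∃ w, Adj v w ∧ l1 w u < l1 v u := by
  obtain ⟨i, hi⟩ := Function.ne_iff.1 huv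
  obtain ⟨e, he, hlt⟩ : ∃ e : ℤ, e.natAbs = 1 ∧ (v i + e - u i).natAbs < (v i - u i).natAbs := by
    obtain hlt | hlt := lt_or_gt_of_ne hi
    · exact ⟨-1, rfl, by omega⟩
    · exact ⟨1, rfl, by omega⟩
  refine ⟨Function.update v i (v i + e), ?_, ?_⟩
  · rw [Adj, l1, Finset.sum_eq_single i (fun j _ hj => by simp [hj]) (by simp)]
    simpa using he
  · refine Finset.sum_lt_sum (fun j _ => ?_) ⟨i, Finset.mem_univ i, by simpa using hlt⟩
    obtain rfl | hj := eq_or_ne j i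
    · simpa using hlt.le
    · rw [Function.update_of_ne hj]

theorem exists_mem_bdry_l1_le {A : Set (Site d)} {v u : Site d} (hv : v ∈ A) (hu : u ∉ A) :
    ∃ w ∈ bdry Set.univ A, l1 v w ≤ l1 v u := by
  induction hn : l1 v u using Nat.strong_induction_on generalizing v with
  | _ n ih =>
    obtain ⟨w, hadj, hlt⟩ := exists_adj_l1_lt (ne_of_mem_of_not_mem hv hu).symm
    by_cases hw : w ∈ A
    · obtain ⟨z, hz, hle⟩ := ih (l1 w u) (hn ▸ hlt) hw rfl
      have triangle := l1_triangle v w z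
      rw [show l1 v w = 1 from hadj] at triangle
      exact ⟨z, hz, by omega⟩
    · exact ⟨v, ⟨hv, w, Set.mem_univ w, hadj, hw⟩, by simp [l1]⟩

theorem ball_subset_shift {Λ : Finset (Site d)} {v : Site d} (hv : v ∈ Λ) {r : ℕ}
    (hr : ∀ w ∈ bdry Set.univ (Λ : Set (Site d)), r < l1 v w) : ball {0} r ⊆ shift Λ v := by
  intro u hu
  rw [mem_ball] at hu
  obtain ⟨z, hz, hu⟩ := hu
  rw [Finset.mem_singleton] at hz
  subst hz
  rw [mem_shift]
  by_contra hmem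
  obtain ⟨w, hw, hle⟩ := exists_mem_bdry_l1_le (A := (Λ : Set (Site d))) hv hmem
  have l1_eq : l1 v (u + v) = l1 u 0 := by simp [l1]
  exact (hr w hw).not_ge (hle.trans (l1_eq.trans_le hu))

theorem zero_mem_shift {Λ : Finset (Site d)} {v : Site d} : 0 ∈ shift Λ v ↔ v ∈ Λ := by
  rw [mem_shift, zero_add]

theorem finite_bdry (D : Set (Site d)) (Λ : Finset (Site d)) : (bdry D (Λ : Set (Site d))).Finite :=
  Λ.finite_toSet.subset fun _ hv => hv.1

theorem card_upperBdry_le (Λ : Finset (Site d)) (j : Fin d) :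
    (upperBdry Λ j).card ≤ (bdry Set.univ (Λ : Set (Site d))).ncard := by
  rw [← Set.ncard_coe_finset]
  refine Set.ncard_le_ncard (fun v hv => ?_) (finite_bdry _ Λ)
  obtain ⟨hv, hadd⟩ := Finset.mem_filter.1 (Finset.mem_coe.1 hv)
  exact ⟨hv, _, Set.mem_univ _, (adj_and_lexLT_iff.2 ⟨j, rfl⟩).1, hadd⟩

variable {χ : Type*} {H : χ → χ → WithTop ℝ} {h : χ → ℝ} [Fintype χ] [MeasurableSpace χ]
  [MeasurableSingletonClass χ] {s : χ} {p : ℝ}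

theorem exists_abs_sum_log_sub_le (hsymm : ∀ s t, H s t = H t s) (hs : ∀ t, H t s ≠ ⊤)
    (hp : IsCavityMarginal H h (Set.univ : Set (Site d)) s p) {ε : ℝ} (hε : 0 < ε) :
    ∃ K : ℝ, ∀ Λ : Finset (Site d),
      |∑ v ∈ Λ, (Real.log p - Real.log (cavityProb H h s (shift Λ v)))| ≤
        ε * Λ.card + K * (bdry Set.univ (Λ : Set (Site d))).ncard := by
  obtain ⟨C, hC, hlip⟩ := exists_abs_log_sub_le_mul (d := d) (h := h) hsymm hs
  obtain ⟨M, hM⟩ := hp.exists_abs_log_sub_lt (hp.pos hsymm hs trivial).ne' hε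
  refine ⟨C * (2 * M + 1) ^ d, fun Λ => ?_⟩
  have hq (v : Site d) := isCavityMarginal_cavityProb (h := h) (hs s) (shift Λ v)
  set B := (finite_bdry Set.univ Λ).toFinset
  have card_B : B.card = (bdry Set.univ (Λ : Set (Site d))).ncard :=
    (Set.ncard_eq_toFinset_card _ _).symm
  have sum_le : |∑ v ∈ Λ, (Real.log p - Real.log (cavityProb H h s (shift Λ v)))| ≤
      ε * Λ.card + C * (Λ.filter (· ∈ ball B M)).card := by
    refine abs_sum_le_mul_card_add_mul_card_filter hε.le (fun v hv _ => ?_) fun v hv hvB => ?_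
    · exact (hlip _ _ (Set.mem_univ _) (zero_mem_shift.2 hv) p _ hp (hq v)).trans
        (mul_le_of_le_one_right hC (hp.abs_sub_le_one (hq v)))
    · refine (hM _ _ (Finset.coe_subset.2 (ball_subset_shift hv fun w hw => ?_)) (hq v)).le
      exact not_le.1 fun hle => hvB (mem_ball.2 ⟨w, (Set.Finite.mem_toFinset _).2 hw, hle⟩)
  calc |∑ v ∈ Λ, (Real.log p - Real.log (cavityProb H h s (shift Λ v)))|
      ≤ ε * Λ.card + C * (Λ.filter (· ∈ ball B M)).card := sum_le
    _ ≤ ε * Λ.card + C * (B.card * (2 * M + 1) ^ d : ℕ) := by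
        gcongr
        exact (Finset.card_le_card fun v hv => (Finset.mem_filter.1 hv).2).trans (card_ball_le B M)
    _ = _ := by
        rw [card_B]
        push_cast
        ring

theorem exists_abs_log_partitionFn_sub_le (hsymm : ∀ s t, H s t = H t s) (hs : ∀ t, H t s ≠ ⊤)
    {x : ℝ} (hx : H s s = x) (hp : IsCavityMarginal H h (Set.univ : Set (Site d)) s p)
    {ε : ℝ} (hε : 0 < ε) :
    ∃ K : ℝ, ∀ Λ : Finset (Site d),
      |Real.log (partitionFn H h Λ) - Λ.card * (-Real.log p - d * x - h s)| ≤
        ε * Λ.card + K * (bdry Set.univ (Λ : Set (Site d))).ncard := by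
  obtain ⟨K, hK⟩ := exists_abs_sum_log_sub_le (h := h) hsymm hs hp hε
  refine ⟨|x| * d + K, fun Λ => ?_⟩
  have sum_upperBdry_le : |x * ∑ j, ((upperBdry Λ j).card : ℝ)| ≤
      |x| * (d * (bdry Set.univ (Λ : Set (Site d))).ncard) := by
    rw [abs_mul, ← Nat.cast_sum, Nat.abs_cast, Nat.cast_sum]
    gcongr
    simpa using Finset.sum_le_card_nsmul Finset.univ (fun j => ((upperBdry Λ j).card : ℝ)) _
      fun j _ => Nat.cast_le.2 (card_upperBdry_le Λ j)
  rw [log_partitionFn_sub hx]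
  linarith [abs_add_le (x * ∑ j, ((upperBdry Λ j).card : ℝ))
    (∑ v ∈ Λ, (Real.log p - Real.log (cavityProb H h s (shift Λ v)))), hK Λ]

theorem isFreeEnergy_of_isCavityMarginal (hsymm : ∀ s t, H s t = H t s) (hs : ∀ t, H t s ≠ ⊤)
    {x : ℝ} (hx : H s s = x) (hp : IsCavityMarginal H h (Set.univ : Set (Site d)) s p) :
    IsFreeEnergy d H h (-Real.log p - d * x - h s) := by
  intro Λ hne hbdry
  refine Metric.tendsto_nhds.2 fun ε hε => ?_
  obtain ⟨K, hK⟩ := exists_abs_log_partitionFn_sub_le (h := h) hsymm hs hx hp (half_pos hε)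
  have bdry_lt := (hbdry.const_mul K).eventually_lt_const
    (show K * 0 < ε / 2 by rw [mul_zero]; exact half_pos hε)
  filter_upwards [bdry_lt] with n hn
  have card_pos : (0 : ℝ) < (Λ n).card := Nat.cast_pos.2 (Finset.card_pos.2 (hne n))
  rw [← mul_div_assoc, div_lt_iff₀ card_pos] at hn
  rw [Real.dist_eq, div_sub' card_pos.ne', abs_div, abs_of_pos card_pos, div_lt_iff₀ card_pos]
  linarith [hK (Λ n)]

end FreeEnergy

section Boxes

theorem card_filter_piFinset_mul {ι κ : Type*} [Fintype ι] [DecidableEq ι]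
    (I : ι → Finset κ) (j : ι) (P : κ → Prop) [DecidablePred P] :
    ((Fintype.piFinset I).filter fun v => P (v j)).card * (I j).card =
      ((I j).filter P).card * (Fintype.piFinset I).card := by
  classical
  have filter_eq : ((Fintype.piFinset I).filter fun v => P (v j)) =
      Fintype.piFinset (Function.update I j ((I j).filter P)) := by
    rw [Fintype.piFinset_update_eq_filter_piFinset_mem _ _ (Finset.filter_subset _ _)]
    refine Finset.filter_congr fun v hv => ?_
    rw [Finset.mem_filter, and_iff_right (Fintype.mem_piFinset.1 hv j)]
  rw [filter_eq, Fintype.card_piFinset, Fintype.card_piFinset,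
    ← Finset.mul_prod_erase _ _ (Finset.mem_univ j),
    ← Finset.mul_prod_erase _ (fun i => (I i).card) (Finset.mem_univ j), Function.update_self,
    Finset.prod_congr rfl fun i hi => by rw [Function.update_of_ne (Finset.ne_of_mem_erase hi)]]
  ring

/-- The distance of `t` to an endpoint of the interval `[-n, n]`: the upper one if `b` is `true`,
the lower one otherwise. -/
def endDist (n : ℕ) (b : Bool) (t : ℤ) : ℕ := if b then (n - t).toNat else (n + t).toNat

theorem card_Icc_neg (n : ℕ) : (Finset.Icc (-(n : ℤ)) n).card = 2 * n + 1 := by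
  rw [Int.card_Icc]
  omega

theorem image_endDist (n : ℕ) (b : Bool) :
    (Finset.Icc (-(n : ℤ)) n).image (endDist n b) = Finset.range (2 * n + 1) := by
  ext k
  simp only [Finset.mem_image, Finset.mem_Icc, Finset.mem_range]
  constructor
  · rintro ⟨t, ht, rfl⟩
    unfold endDist
    split_ifs <;> omega
  · intro hk
    cases b
    · exact ⟨k - n, by omega, by simp [endDist]⟩
    · exact ⟨n - k, by omega, by simp [endDist]⟩

theorem injOn_endDist (n : ℕ) (b : Bool) : Set.InjOn (endDist n b) (Finset.Icc (-(n : ℤ)) n) := by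
  intro t ht t' ht' heq
  rw [Finset.coe_Icc, Set.mem_Icc] at ht ht'
  unfold endDist at heq
  split_ifs at heq <;> omega

theorem card_filter_endDist (n : ℕ) (b : Bool) (P : ℕ → Prop) [DecidablePred P] :
    ((Finset.Icc (-(n : ℤ)) n).filter fun t => P (endDist n b t)).card =
      ((Finset.range (2 * n + 1)).filter P).card := by
  rw [← image_endDist n b, Finset.filter_image, Finset.card_image_of_injOn]
  exact (injOn_endDist n b).mono (Finset.coe_subset.2 (Finset.filter_subset _ _))

variable {d : ℕ}

/-- The box `∏_j [-N_j, N_j]`. -/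
def symBox (N : Fin d → ℕ) : Finset (Site d) :=
  Fintype.piFinset fun j => Finset.Icc (-(N j : ℤ)) (N j)

/-- The number of sites of a face of `symBox N` orthogonal to the `j`-th axis. -/
def faceCard (N : Fin d → ℕ) (j : Fin d) : ℕ := ∏ i ∈ Finset.univ.erase j, (2 * N i + 1)

/-- The distance of `v` to the face `α` of `symBox N`. The faces of a box are indexed by
`Fin d × Bool`: `(j, true)` is the upper and `(j, false)` the lower face in the direction `j`. -/
def faceDist (N : Fin d → ℕ) (v : Site d) (α : Fin d × Bool) : ℕ := endDist (N α.1) α.2 (v α.1)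

/-- The sites of `symBox N` at distance `k` from the face `α`. -/
def slice (N : Fin d → ℕ) (α : Fin d × Bool) (k : ℕ) : Finset (Site d) :=
  (symBox N).filter fun v => faceDist N v α = k

/-- The sites of `slice N α k` at distance less than `M` from the face `β`. -/
def sliceNear (N : Fin d → ℕ) (α : Fin d × Bool) (k : ℕ) (β : Fin d × Bool) (M : ℕ) :
    Finset (Site d) :=
  (slice N α k).filter fun v => faceDist N v β < M

theorem mem_symBox {N : Fin d → ℕ} {v : Site d} :
    v ∈ symBox N ↔ ∀ j, -(N j : ℤ) ≤ v j ∧ v j ≤ N j := by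
  simp only [symBox, Fintype.mem_piFinset, Finset.mem_Icc]

theorem box_eq_symBox {a : Fin d → ℝ} (ha : ∀ j, 0 < a j) (n : ℕ) :
    box a n = symBox fun j => ⌊a j * n⌋₊ := by
  ext v
  have floor_eq (j : Fin d) : ⌊a j * n⌋ = (⌊a j * n⌋₊ : ℤ) :=
    (Int.natCast_floor_eq_floor (mul_nonneg (ha j).le (Nat.cast_nonneg n))).symm
  simp only [box, Finset.mem_Icc, Pi.le_def, mem_symBox, floor_eq, forall_and]

theorem card_symBox (N : Fin d → ℕ) (j : Fin d) :
    (symBox N).card = (2 * N j + 1) * faceCard N j := by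
  simp only [symBox, Fintype.card_piFinset, card_Icc_neg, faceCard]
  exact (Finset.mul_prod_erase _ _ (Finset.mem_univ j)).symm

theorem card_slice (N : Fin d → ℕ) (α : Fin d × Bool) (k : ℕ) :
    (slice N α k).card = ((Finset.range (2 * N α.1 + 1)).filter (· = k)).card * faceCard N α.1 := by
  have card_mul := card_filter_piFinset_mul (fun j => Finset.Icc (-(N j : ℤ)) (N j)) α.1
    fun t => endDist (N α.1) α.2 t = k
  rw [card_Icc_neg, card_filter_endDist _ _ (· = k)] at card_mul
  refine Nat.eq_of_mul_eq_mul_right (show 0 < 2 * N α.1 + 1 from Nat.succ_pos _) (card_mul.trans ?_)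
  rw [← symBox, card_symBox N α.1]
  ring

theorem card_slice_of_le {N : Fin d → ℕ} {α : Fin d × Bool} {k : ℕ} (hk : k ≤ 2 * N α.1) :
    (slice N α k).card = faceCard N α.1 := by
  rw [card_slice, Finset.filter_eq', if_pos (Finset.mem_range.2 (Nat.lt_succ_of_le hk)),
    Finset.card_singleton, one_mul]

theorem card_slice_le (N : Fin d → ℕ) (α : Fin d × Bool) (k : ℕ) :
    (slice N α k).card ≤ faceCard N α.1 := by
  rw [card_slice, Finset.filter_eq']
  refine mul_le_of_le_one_left (Nat.zero_le _) ?_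
  split_ifs <;> simp

theorem card_upperBdry_symBox (N : Fin d → ℕ) (j : Fin d) :
    (upperBdry (symBox N) j).card = faceCard N j := by
  rw [← card_slice_of_le (α := (j, true)) (Nat.zero_le _)]
  refine congrArg _ (Finset.filter_congr fun v hv => ?_)
  have hv := mem_symBox.1 hv
  simp only [mem_symBox, faceDist, endDist, if_true, not_forall]
  constructor
  · rintro ⟨i, hi⟩
    have := hv i
    obtain rfl | hij := eq_or_ne i j
    · rw [Pi.add_apply, Pi.single_eq_same] at hi
      omega
    · rw [Pi.add_apply, Pi.single_eq_of_ne hij] at hi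
      omega
  · intro h0
    refine ⟨j, ?_⟩
    rw [Pi.add_apply, Pi.single_eq_same]
    omega

theorem card_sliceNear_mul_le (N : Fin d → ℕ) {α β : Fin d × Bool} (hαβ : β.1 ≠ α.1) (k M : ℕ) :
    (sliceNear N α k β M).card * (2 * N β.1 + 1) ≤ M * faceCard N α.1 := by
  let I (j : Fin d) : Finset ℤ := Finset.Icc (-(N j : ℤ)) (N j)
  have slice_eq : slice N α k = Fintype.piFinset
      (Function.update I α.1 ((I α.1).filter fun t => endDist (N α.1) α.2 t = k)) := by
    rw [Fintype.piFinset_update_eq_filter_piFinset_mem _ _ (Finset.filter_subset _ _)]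
    refine Finset.filter_congr fun v hv => ?_
    rw [Finset.mem_filter, and_iff_right (Fintype.mem_piFinset.1 hv α.1), faceDist]
  have card_mul := card_filter_piFinset_mul
    (Function.update I α.1 ((I α.1).filter fun t => endDist (N α.1) α.2 t = k)) β.1
    fun t => endDist (N β.1) β.2 t < M
  rw [← slice_eq, Function.update_of_ne hαβ, card_Icc_neg, card_filter_endDist _ _ (· < M)]
    at card_mul
  refine card_mul.trans_le (Nat.mul_le_mul ?_ (card_slice_le N α k))
  exact (Finset.card_le_card fun t ht => Finset.mem_range.2 (Finset.mem_filter.1 ht).2).trans_eq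
    (Finset.card_range M)

theorem sliceNear_eq_empty {N : Fin d → ℕ} {α β : Fin d × Bool} (hαβ : β ≠ α) (hfst : β.1 = α.1)
    {k M : ℕ} (hkM : k + M ≤ 2 * N α.1) : sliceNear N α k β M = ∅ := by
  refine Finset.filter_eq_empty_iff.2 fun v hv => not_lt.2 ?_
  obtain ⟨hbox, hk⟩ := Finset.mem_filter.1 hv
  obtain ⟨j, a⟩ := α
  obtain ⟨i, b⟩ := β
  obtain rfl : i = j := hfst
  have hbox := mem_symBox.1 hbox i
  cases a <;> cases b <;> simp [faceDist, endDist] at hk hαβ hkM ⊢ <;> omega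

theorem tendsto_card_sliceNear_div {N : ℕ → Fin d → ℕ}
    (hN : ∀ j, Tendsto (fun n => N n j) atTop atTop) {α β : Fin d × Bool} (hαβ : β ≠ α) (k M : ℕ) :
    Tendsto (fun n => ((sliceNear (N n) α k β M).card : ℝ) / faceCard (N n) α.1) atTop (𝓝 0) := by
  by_cases hfst : β.1 = α.1
  · refine tendsto_const_nhds.congr' ?_
    filter_upwards [(hN α.1).eventually_ge_atTop (k + M)] with n hn
    rw [sliceNear_eq_empty hαβ hfst (by omega), Finset.card_empty, Nat.cast_zero, zero_div]
  · have width_tendsto : Tendsto (fun n => ((2 * N n β.1 + 1 : ℕ) : ℝ)) atTop atTop :=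
      tendsto_natCast_atTop_atTop.comp (tendsto_atTop_mono (fun n => by omega) (hN β.1))
    refine squeeze_zero (fun n => by positivity) (fun n => ?_)
      (width_tendsto.const_div_atTop (M : ℝ))
    have face_pos : (0 : ℝ) < faceCard (N n) α.1 :=
      Nat.cast_pos.2 (Finset.prod_pos fun _ _ => Nat.succ_pos _)
    rw [div_le_div_iff₀ face_pos (Nat.cast_pos.2 (Nat.succ_pos _))]
    exact_mod_cast card_sliceNear_mul_le (N n) hfst k M

end Boxes

section FaceSums

variable {d : ℕ}

/-- The filter on pairs `(N, v)` of a box `symBox N` and a site `v` of it at distance `k` from the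
face `α`, along which the distance of `v` to every other face tends to infinity. -/
def faceFilter (α : Fin d × Bool) (k : ℕ) : Filter ((Fin d → ℕ) × Site d) :=
  ⨅ M : ℕ, 𝓟 {q | q.2 ∈ slice q.1 α k ∧ ∀ β ≠ α, M ≤ faceDist q.1 q.2 β}

theorem eventually_faceFilter {α : Fin d × Bool} {k : ℕ} {P : (Fin d → ℕ) × Site d → Prop} :
    (∀ᶠ q in faceFilter α k, P q) ↔ ∃ M : ℕ, ∀ N, ∀ v ∈ slice N α k,
      (∀ β ≠ α, M ≤ faceDist N v β) → P (N, v) := by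
  have antitone : Antitone fun M : ℕ => {q : (Fin d → ℕ) × Site d |
      q.2 ∈ slice q.1 α k ∧ ∀ β ≠ α, M ≤ faceDist q.1 q.2 β} :=
    fun M M' hM q hq => ⟨hq.1, fun β hβ => hM.trans (hq.2 β hβ)⟩
  rw [faceFilter, (hasBasis_iInf_principal antitone.directed_ge).eventually_iff]
  simp only [true_and, Set.mem_ofPred_eq, and_imp, Prod.forall]

theorem tendsto_faceDist_faceFilter {α β : Fin d × Bool} (hβ : β ≠ α) (k : ℕ) :
    Tendsto (fun q => faceDist q.1 q.2 β) (faceFilter α k) atTop :=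
  tendsto_atTop.2 fun M => eventually_faceFilter.2 ⟨M, fun _ _ _ hM => hM β hβ⟩

theorem tendsto_sum_slice_div {N : ℕ → Fin d → ℕ} (hN : ∀ j, Tendsto (fun n => N n j) atTop atTop)
    {α : Fin d × Bool} {k : ℕ} {g : (Fin d → ℕ) × Site d → ℝ} {C y : ℝ}
    (hg : ∀ N, ∀ v ∈ slice N α k, |g (N, v)| ≤ C) (hy : Tendsto g (faceFilter α k) (𝓝 y)) :
    Tendsto (fun n => (∑ v ∈ slice (N n) α k, g (N n, v)) / faceCard (N n) α.1) atTop (𝓝 y) := by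
  refine Metric.tendsto_nhds.2 fun ε hε => ?_
  obtain ⟨M, hM⟩ := eventually_faceFilter.1 (Metric.tendsto_nhds.1 hy (ε / 2) (half_pos hε))
  have near_lt := ((tendsto_finsetSum (Finset.univ.erase α) fun β hβ =>
    tendsto_card_sliceNear_div hN (Finset.ne_of_mem_erase hβ) k M).const_mul
      (|C| + |y|)).eventually_lt_const (u := ε / 2) (by simpa using half_pos hε)
  filter_upwards [near_lt, (hN α.1).eventually_ge_atTop k] with n hn hk
  have face_pos : (0 : ℝ) < faceCard (N n) α.1 :=
    Nat.cast_pos.2 (Finset.prod_pos fun _ _ => Nat.succ_pos _)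
  have card_eq : ((slice (N n) α k).card : ℝ) = faceCard (N n) α.1 := by
    rw [card_slice_of_le (by omega)]
  have card_near_le : (((slice (N n) α k).filter fun v =>
      ∃ β ≠ α, faceDist (N n) v β < M).card : ℝ) ≤
      ∑ β ∈ Finset.univ.erase α, ((sliceNear (N n) α k β M).card : ℝ) := by
    rw [← Nat.cast_sum]
    refine Nat.cast_le.2 ((Finset.card_le_card fun v hv => ?_).trans Finset.card_biUnion_le)
    obtain ⟨hv, β, hβ, hlt⟩ := Finset.mem_filter.1 hv
    exact Finset.mem_biUnion.2 ⟨β, Finset.mem_erase.2 ⟨hβ, Finset.mem_univ β⟩,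
      Finset.mem_filter.2 ⟨hv, hlt⟩⟩
  have sum_le := abs_sum_le_mul_card_add_mul_card_filter (t := slice (N n) α k)
    (P := fun v => ∃ β ≠ α, faceDist (N n) v β < M) (f := fun v => g (N n, v) - y) (half_pos hε).le
    (fun v hv _ => (abs_sub _ _).trans (add_le_add_left ((hg _ v hv).trans (le_abs_self C)) _))
    fun v hv hfar => (hM _ v hv (by simpa using hfar)).le
  rw [Finset.sum_sub_distrib, Finset.sum_const, nsmul_eq_mul, card_eq] at sum_le
  rw [← Finset.sum_div, ← mul_div_assoc, div_lt_iff₀ face_pos] at hn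
  rw [Real.dist_eq, div_sub' face_pos.ne', abs_div, abs_of_pos face_pos, div_lt_iff₀ face_pos]
  linarith [mul_le_mul_of_nonneg_left card_near_le (by positivity : 0 ≤ |C| + |y|)]

theorem tendsto_sum_symBox_div_faceCard {N : ℕ → Fin d → ℕ}
    (hN : ∀ j, Tendsto (fun n => N n j) atTop atTop) {α : Fin d × Bool}
    {g : (Fin d → ℕ) × Site d → ℝ} {ψ b : ℕ → ℝ} (hb : Summable b)
    (hg : ∀ N, ∀ v ∈ symBox N, |g (N, v)| ≤ b (faceDist N v α))
    (hψ : ∀ k, Tendsto g (faceFilter α k) (𝓝 (ψ k))) :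
    Tendsto (fun n => (∑ v ∈ symBox (N n), g (N n, v)) / faceCard (N n) α.1) atTop
      (𝓝 (∑' k, ψ k)) := by
  have hg_slice (k : ℕ) : ∀ N, ∀ v ∈ slice N α k, |g (N, v)| ≤ b k := fun N v hv => by
    obtain ⟨hbox, rfl⟩ := Finset.mem_filter.1 hv
    exact hg N v hbox
  have slice_le (n k : ℕ) :
      ‖(∑ v ∈ slice (N n) α k, g (N n, v)) / faceCard (N n) α.1‖ ≤ |b k| := by
    rw [Real.norm_eq_abs, abs_div, Nat.abs_cast]
    refine div_le_of_le_mul₀ (Nat.cast_nonneg _) (abs_nonneg _) ?_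
    calc |∑ v ∈ slice (N n) α k, g (N n, v)| ≤ ∑ _v ∈ slice (N n) α k, |b k| :=
          (Finset.abs_sum_le_sum_abs _ _).trans (Finset.sum_le_sum fun v hv =>
            (hg_slice k _ v hv).trans (le_abs_self _))
      _ ≤ |b k| * faceCard (N n) α.1 := by
          rw [Finset.sum_const, nsmul_eq_mul, mul_comm]
          gcongr
          exact card_slice_le _ _ _
  refine (tendsto_tsum_of_dominated_convergence hb.abs
    (fun k => tendsto_sum_slice_div hN (hg_slice k) (hψ k))
    (Eventually.of_forall slice_le)).congr fun n => ?_
  rw [tsum_div_const]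
  congr 1
  rw [tsum_eq_sum (s := (symBox (N n)).image fun v => faceDist (N n) v α) fun k hk => ?_]
  · exact Finset.sum_fiberwise_of_maps_to (fun v hv => Finset.mem_image_of_mem _ hv) _
  · refine Finset.sum_eq_zero fun v hv => ?_
    obtain ⟨hbox, rfl⟩ := Finset.mem_filter.1 hv
    exact (hk (Finset.mem_image_of_mem _ hbox)).elim

end FaceSums

section PartitionOfUnity

variable {d : ℕ} {θ : ℝ}

/-- The share of the site `v` of `symBox N` that is attributed to the face `α`: the shares of the
faces sum to `1`, and the share of a face decays geometrically with the distance to it. -/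
def faceShare (θ : ℝ) (N : Fin d → ℕ) (v : Site d) (α : Fin d × Bool) : ℝ :=
  θ ^ faceDist N v α / ∑ β, θ ^ faceDist N v β

theorem tendsto_faceShare_faceFilter (hθ : θ ∈ Set.Ioo 0 1) (α : Fin d × Bool) (k : ℕ) :
    Tendsto (fun q => faceShare θ q.1 q.2 α) (faceFilter α k) (𝓝 1) := by
  have near : Tendsto (fun q => θ ^ faceDist q.1 q.2 α) (faceFilter α k) (𝓝 (θ ^ k)) :=
    tendsto_const_nhds.congr' <| eventually_faceFilter.2
      ⟨0, fun N v hv _ => by rw [← (Finset.mem_filter.1 hv).2]⟩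
  have far : Tendsto (fun q => ∑ β ∈ Finset.univ.erase α, θ ^ faceDist q.1 q.2 β) (faceFilter α k)
      (𝓝 0) := by
    simpa only [Finset.sum_const_zero, Function.comp_apply] using
      tendsto_finsetSum (Finset.univ.erase α) fun β hβ =>
        (tendsto_pow_atTop_nhds_zero_of_lt_one hθ.1.le hθ.2).comp
          (tendsto_faceDist_faceFilter (Finset.ne_of_mem_erase hβ) k)
  have total : Tendsto (fun q => ∑ β, θ ^ faceDist q.1 q.2 β) (faceFilter α k) (𝓝 (θ ^ k)) := by
    rw [← add_zero (θ ^ k)]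
    exact (near.add far).congr fun q =>
      Finset.add_sum_erase Finset.univ (fun β => θ ^ faceDist q.1 q.2 β) (Finset.mem_univ α)
  have pow_ne : θ ^ k ≠ 0 := (pow_pos hθ.1 k).ne'
  rw [← div_self pow_ne]
  exact near.div total pow_ne

theorem abs_mul_faceShare_le (hθ : θ ∈ Set.Ioo 0 1) {N : Fin d → ℕ} {v : Site d} {y C : ℝ}
    (hy : |y| ≤ C * ∑ β, θ ^ faceDist N v β) (α : Fin d × Bool) :
    |y * faceShare θ N v α| ≤ C * θ ^ faceDist N v α := by
  have pow_pos (β : Fin d × Bool) : 0 < θ ^ faceDist N v β := pow_pos hθ.1 _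
  have sum_pos : 0 < ∑ β, θ ^ faceDist N v β :=
    Finset.sum_pos (fun β _ => pow_pos β) ⟨α, Finset.mem_univ α⟩
  rw [faceShare, abs_mul, abs_of_pos (div_pos (pow_pos α) sum_pos), mul_div_left_comm, mul_comm C]
  exact mul_le_mul_of_nonneg_left ((div_le_iff₀ sum_pos).2 hy) (pow_pos α).le

theorem tendsto_sum_symBox_div {N : ℕ → Fin d → ℕ} (hN : ∀ j, Tendsto (fun n => N n j) atTop atTop)
    {r : ℕ → ℝ} {A : Fin d → ℝ}
    (hr : ∀ j, Tendsto (fun n => (faceCard (N n) j : ℝ) / r n) atTop (𝓝 (A j)))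
    {f : (Fin d → ℕ) × Site d → ℝ} {C : ℝ} (hθ : θ ∈ Set.Ioo 0 1)
    (hf : ∀ N, ∀ v ∈ symBox N, |f (N, v)| ≤ C * ∑ β, θ ^ faceDist N v β)
    {ψ : Fin d × Bool → ℕ → ℝ} (hψ : ∀ α k, Tendsto f (faceFilter α k) (𝓝 (ψ α k))) :
    Tendsto (fun n => (∑ v ∈ symBox (N n), f (N n, v)) / r n) atTop
      (𝓝 (∑ α, A α.1 * ∑' k, ψ α k)) := by
  have share_tendsto (α : Fin d × Bool) :
      Tendsto (fun n => (∑ v ∈ symBox (N n), f (N n, v) * faceShare θ (N n) v α) /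
        faceCard (N n) α.1) atTop (𝓝 (∑' k, ψ α k)) :=
    tendsto_sum_symBox_div_faceCard hN (g := fun q => f q * faceShare θ q.1 q.2 α)
      ((summable_geometric_of_lt_one hθ.1.le hθ.2).mul_left C)
      (fun N v hv => abs_mul_faceShare_le hθ (hf N v hv) α)
      fun k => by simpa only [mul_one] using (hψ α k).mul (tendsto_faceShare_faceFilter hθ α k)
  refine (tendsto_finsetSum Finset.univ fun α _ => (hr α.1).mul (share_tendsto α)).congr fun n => ?_
  have f_eq {v : Site d} (hv : v ∈ symBox (N n)) :
      ∑ α, f (N n, v) * faceShare θ (N n) v α = f (N n, v) := by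
    simp only [faceShare]
    rw [← Finset.mul_sum, ← Finset.sum_div, ← mul_div_assoc]
    refine mul_div_cancel_of_imp fun h0 => abs_nonpos_iff.1 ?_
    simpa only [h0, mul_zero] using hf (N n) v hv
  rw [← Finset.sum_congr rfl fun v hv => f_eq hv, Finset.sum_comm, Finset.sum_div]
  refine Finset.sum_congr rfl fun α _ => ?_
  have face_ne : (faceCard (N n) α.1 : ℝ) ≠ 0 :=
    Nat.cast_ne_zero.2 (Finset.prod_pos fun _ _ => Nat.succ_pos _).ne'
  field_simp

theorem tendsto_floor_mul_atTop {a : ℝ} (ha : 0 < a) :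
    Tendsto (fun n : ℕ => ⌊a * n⌋₊) atTop atTop :=
  tendsto_nat_floor_atTop.comp (tendsto_natCast_atTop_atTop.const_mul_atTop ha)

theorem tendsto_faceCard_div {a : Fin d → ℝ} (ha : ∀ j, 0 < a j) (j : Fin d) :
    Tendsto (fun n : ℕ => (faceCard (fun i => ⌊a i * n⌋₊) j : ℝ) / (n : ℝ) ^ (d - 1)) atTop
      (𝓝 (faceArea a j)) := by
  have width_tendsto (i : Fin d) :
      Tendsto (fun n : ℕ => ((2 * ⌊a i * n⌋₊ + 1 : ℕ) : ℝ) / n) atTop (𝓝 (2 * a i)) := by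
    have floor_tendsto := (tendsto_nat_floor_mul_div_atTop (ha i).le).comp
      tendsto_natCast_atTop_atTop
    simpa only [Function.comp_def, Nat.cast_add, Nat.cast_mul, Nat.cast_ofNat, Nat.cast_one,
      add_div, mul_div_assoc, add_zero] using
      (floor_tendsto.const_mul 2).add (tendsto_one_div_atTop_nhds_zero_nat (𝕜 := ℝ))
  refine (tendsto_finsetProd (Finset.univ.erase j) fun i _ => width_tendsto i).congr fun n => ?_
  rw [Finset.prod_div_distrib, Finset.prod_const, Finset.card_erase_of_mem (Finset.mem_univ j),
    Finset.card_univ, Fintype.card_fin, faceCard, Nat.cast_prod]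

end PartitionOfUnity

section HalfSpace

variable {d : ℕ}

/-- The half-space `ℤ^d_{j,k,+}` if `α` is the upper face `(j, true)` and `ℤ^d_{j,k,-}` if it is the
lower face `(j, false)`; this is what a box looks like, away from its other faces, from a site at
distance `k` from the face `α`. -/
def halfSpace (α : Fin d × Bool) (k : ℕ) : Set (Site d) :=
  if α.2 then halfPlus α.1 k else halfMinus α.1 k

theorem mem_halfSpace {α : Fin d × Bool} {k : ℕ} {u : Site d} :
    u ∈ halfSpace α k ↔ if α.2 then u α.1 ≤ k else -(k : ℤ) ≤ u α.1 := by
  unfold halfSpace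
  split_ifs <;> rfl

theorem mem_ball_zero {r : ℕ} {u : Site d} : u ∈ ball {0} r ↔ l1 u 0 ≤ r := by
  simp only [mem_ball, Finset.mem_singleton, exists_eq_left]

theorem mem_halfSpace_of_l1_le {α : Fin d × Bool} {k : ℕ} {u : Site d} (hu : l1 u 0 ≤ k) :
    u ∈ halfSpace α k := by
  have coord_le : (u α.1 - 0).natAbs ≤ k :=
    (Finset.single_le_sum (f := fun i => (u i - 0).natAbs) (fun _ _ => Nat.zero_le _)
      (Finset.mem_univ α.1)).trans hu
  rw [mem_halfSpace]
  split_ifs <;> omega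

theorem ball_subset_halfSpace (α : Fin d × Bool) (k : ℕ) :
    (ball {(0 : Site d)} k : Set (Site d)) ⊆ halfSpace α k :=
  fun _ hu => mem_halfSpace_of_l1_le (mem_ball_zero.1 (Finset.mem_coe.1 hu))

theorem zero_mem_halfSpace (α : Fin d × Bool) (k : ℕ) : 0 ∈ halfSpace α k :=
  ball_subset_halfSpace α k (Finset.mem_coe.2 (mem_ball_zero.2 (by simp [l1])))

theorem mem_shift_symBox {N : Fin d → ℕ} {v : Site d} (hv : v ∈ symBox N) {u : Site d} :
    u ∈ shift (symBox N) v ↔ ∀ α, u ∈ halfSpace α (faceDist N v α) := by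
  rw [mem_symBox] at hv
  simp only [mem_shift, mem_symBox, mem_halfSpace, faceDist, endDist, Prod.forall,
    Bool.forall_bool, Bool.false_eq_true, if_false, if_true, Pi.add_apply]
  refine forall_congr' fun j => ?_
  have := hv j
  omega

theorem ball_subset_shift_symBox {N : Fin d → ℕ} {v : Site d} (hv : v ∈ symBox N) {m : ℕ}
    (hm : ∀ α, m ≤ faceDist N v α) : ball {0} m ⊆ shift (symBox N) v := fun _ hu =>
  (mem_shift_symBox hv).2 fun α => mem_halfSpace_of_l1_le ((mem_ball_zero.1 hu).trans (hm α))

theorem eventually_mem_shift_symBox_iff (α : Fin d × Bool) (k : ℕ) (u : Site d) :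
    ∀ᶠ q in faceFilter α k,
      (u ∈ (shift (symBox q.1) q.2 : Set (Site d)) ↔ u ∈ halfSpace α k) := by
  refine eventually_faceFilter.2 ⟨l1 u 0, fun N v hv hfar => ?_⟩
  obtain ⟨hbox, rfl⟩ := Finset.mem_filter.1 hv
  rw [Finset.mem_coe, mem_shift_symBox hbox]
  refine ⟨fun hall => hall α, fun hα β => ?_⟩
  obtain rfl | hβ := eq_or_ne β α
  · exact hα
  · exact mem_halfSpace_of_l1_le (hfar β hβ)

end HalfSpace

section SurfacePressure

theorem sum_mul_tsum_prod_bool {ι : Type*} [Fintype ι] (w : ι → ℝ) {ψ : ι × Bool → ℕ → ℝ}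
    (hψ : ∀ α, Summable (ψ α)) :
    ∑ α, w α.1 * ∑' k, ψ α k = ∑ j, w j * ∑' k, (ψ (j, true) k + ψ (j, false) k) := by
  simp only [Fintype.sum_prod_type, Fintype.sum_bool, (hψ _).tsum_add (hψ _), mul_add]

variable {d : ℕ} {χ : Type*} {H : χ → χ → WithTop ℝ} {h : χ → ℝ} [Fintype χ] [MeasurableSpace χ]
  [MeasurableSingletonClass χ] {s : χ} {p : ℝ} {q : Fin d × Bool → ℕ → ℝ}

theorem summable_log_sub_log_halfSpace (hsymm : ∀ s t, H s t = H t s) (hs : ∀ t, H t s ≠ ⊤)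
    (hExp : ExpSSM d H h) (hp : IsCavityMarginal H h (Set.univ : Set (Site d)) s p)
    (hq : ∀ α k, IsCavityMarginal H h (halfSpace α k) s (q α k)) (α : Fin d × Bool) :
    Summable fun k => Real.log p - Real.log (q α k) := by
  obtain ⟨C, θ, hθ, hgeom⟩ := exists_abs_log_sub_le_geometric (s := s) hsymm hs hExp
  exact .of_norm_bounded ((summable_geometric_of_lt_one hθ.1.le hθ.2).mul_left C) fun k =>
    hgeom k _ _ (Set.subset_univ _) (ball_subset_halfSpace α k) _ _ hp (hq α k)

theorem exists_abs_log_sub_log_cavityProb_symBox_le (hd : 1 ≤ d) (hsymm : ∀ s t, H s t = H t s)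
    (hs : ∀ t, H t s ≠ ⊤) (hExp : ExpSSM d H h)
    (hp : IsCavityMarginal H h (Set.univ : Set (Site d)) s p) :
    ∃ C, ∃ θ ∈ Set.Ioo (0 : ℝ) 1, ∀ N, ∀ v ∈ symBox N,
      |Real.log p - Real.log (cavityProb H h s (shift (symBox N) v))| ≤
        C * ∑ α : Fin d × Bool, θ ^ faceDist N v α := by
  obtain ⟨C, θ, hθ, hgeom⟩ := exists_abs_log_sub_le_geometric (s := s) hsymm hs hExp
  refine ⟨|C|, θ, hθ, fun N v hv => ?_⟩
  have : Nonempty (Fin d × Bool) := ⟨(⟨0, hd⟩, true)⟩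
  obtain ⟨nearest, hnearest⟩ := Finite.exists_min (faceDist N v)
  calc |Real.log p - Real.log (cavityProb H h s (shift (symBox N) v))|
      ≤ C * θ ^ faceDist N v nearest :=
        hgeom _ _ _ (Set.subset_univ _)
          (Finset.coe_subset.2 (ball_subset_shift_symBox hv hnearest)) _ _ hp
          (isCavityMarginal_cavityProb (hs s) _)
    _ ≤ |C| * ∑ α, θ ^ faceDist N v α :=
        mul_le_mul (le_abs_self C)
          (Finset.single_le_sum (f := fun α => θ ^ faceDist N v α)
            (fun α _ => pow_nonneg hθ.1.le _) (Finset.mem_univ nearest))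
          (pow_nonneg hθ.1.le _) (abs_nonneg C)

theorem tendsto_log_sub_log_cavityProb_symBox (hsymm : ∀ s t, H s t = H t s)
    (hs : ∀ t, H t s ≠ ⊤) {α : Fin d × Bool} {k : ℕ} {y : ℝ}
    (hy : IsCavityMarginal H h (halfSpace α k) s y) :
    Tendsto (fun q => Real.log p - Real.log (cavityProb H h s (shift (symBox q.1) q.2)))
      (faceFilter α k) (𝓝 (Real.log p - Real.log y)) :=
  ((hy.tendsto (zero_mem_halfSpace α k) (fun _ => isCavityMarginal_cavityProb (hs s) _)
    (eventually_mem_shift_symBox_iff α k)).log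
      (hy.pos hsymm hs (zero_mem_halfSpace α k)).ne').const_sub _

theorem isSurfacePressure_of_isCavityMarginal (hd : 1 ≤ d) (hsymm : ∀ s t, H s t = H t s)
    (hs : ∀ t, H t s ≠ ⊤) {x : ℝ} (hx : H s s = x) (hExp : ExpSSM d H h)
    (hp : IsCavityMarginal H h (Set.univ : Set (Site d)) s p)
    (hq : ∀ α k, IsCavityMarginal H h (halfSpace α k) s (q α k)) {a : Fin d → ℝ}
    (ha : ∀ j, 0 < a j) :
    IsSurfacePressure H h (-Real.log p - d * x - h s) a
      (x + ∑ α, faceArea a α.1 / area a * ∑' k, (Real.log p - Real.log (q α k))) := by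
  obtain ⟨C, θ, hθ, hbound⟩ := exists_abs_log_sub_log_cavityProb_symBox_le hd hsymm hs hExp hp
  have area_pos : 0 < area a := by
    have : Nonempty (Fin d) := ⟨⟨0, hd⟩⟩
    exact Finset.sum_pos (fun j _ => Finset.prod_pos fun i _ => mul_pos two_pos (ha i))
      Finset.univ_nonempty
  have faces_tendsto := (tendsto_finsetSum Finset.univ fun j _ =>
    tendsto_faceCard_div ha j).const_mul x
  have cavity_tendsto := tendsto_sum_symBox_div (fun j => tendsto_floor_mul_atTop (ha j))
    (tendsto_faceCard_div ha) hθ hbound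
    fun α k => tendsto_log_sub_log_cavityProb_symBox hsymm hs (hq α k)
  have limit_eq : (x * ∑ j, faceArea a j +
      ∑ α, faceArea a α.1 * ∑' k, (Real.log p - Real.log (q α k))) / area a =
      x + ∑ α, faceArea a α.1 / area a * ∑' k, (Real.log p - Real.log (q α k)) := by
    rw [← area, add_div, mul_div_cancel_right₀ _ area_pos.ne', Finset.sum_div]
    simp only [div_mul_eq_mul_div]
  rw [IsSurfacePressure, ← limit_eq]
  refine ((faces_tendsto.add cavity_tendsto).div_const (area a)).congr fun n => ?_
  rw [box_eq_symBox ha, log_partitionFn_sub hx]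
  simp only [card_upperBdry_symBox]
  rw [← Finset.sum_div, ← mul_div_assoc, ← add_div, div_div, mul_comm (area a)]

end SurfacePressure

end SpinModel

end

open SpinModel in
theorem theorem1 {d : ℕ} (hd : 1 ≤ d) {χ : Type*} [Fintype χ] [MeasurableSpace χ]
    [MeasurableSingletonClass χ] (H : χ → χ → WithTop ℝ) (hsymm : ∀ s t, H s t = H t s)
    (h : χ → ℝ) (s : χ) (hs : ∀ t, H t s ≠ ⊤) (hSSM : SSM d H h) :
    ∃ p : ℝ, 0 < p ∧ IsCavityMarginal H h (Set.univ : Set (Site d)) s p ∧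
      IsFreeEnergy d H h (-Real.log p - d * (H s s).untop (hs s) - h s) ∧
      (ExpSSM d H h →
        ∀ pPlus pMinus : Fin d → ℕ → ℝ,
          (∀ j k, IsCavityMarginal H h (halfPlus j k) s (pPlus j k)) →
          (∀ j k, IsCavityMarginal H h (halfMinus j k) s (pMinus j k)) →
          (∀ j k, 0 < pPlus j k ∧ 0 < pMinus j k) ∧
          (∀ j, Summable fun k : ℕ =>
            2 * Real.log p - Real.log (pPlus j k) - Real.log (pMinus j k)) ∧
          ∀ a : Fin d → ℝ, (∀ j, 0 < a j) →
            IsSurfacePressure H h (-Real.log p - d * (H s s).untop (hs s) - h s) a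
              ((H s s).untop (hs s) + ∑ j, faceArea a j / area a *
                ∑' k : ℕ, (2 * Real.log p - Real.log (pPlus j k) - Real.log (pMinus j k)))) := by
  have hx : H s s = ((H s s).untop (hs s) : ℝ) := (WithTop.coe_untop _ _).symm
  obtain ⟨p, hp⟩ := exists_isCavityMarginal_univ (hs s) hSSM
  refine ⟨p, hp.pos hsymm hs (Set.mem_univ _), hp,
    isFreeEnergy_of_isCavityMarginal hsymm hs hx hp, fun hExp pPlus pMinus hplus hminus => ?_⟩
  let q (α : Fin d × Bool) (k : ℕ) : ℝ := if α.2 then pPlus α.1 k else pMinus α.1 k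
  have hq : ∀ α k, IsCavityMarginal H h (halfSpace α k) s (q α k) := by
    rintro ⟨j, _ | _⟩ k
    exacts [hminus j k, hplus j k]
  have hpos (α k) : 0 < q α k := (hq α k).pos hsymm hs (zero_mem_halfSpace α k)
  have hsum := summable_log_sub_log_halfSpace hsymm hs hExp hp hq
  have term_eq (j k) : 2 * Real.log p - Real.log (pPlus j k) - Real.log (pMinus j k) =
      (Real.log p - Real.log (q (j, true) k)) + (Real.log p - Real.log (q (j, false) k)) := by
    simp only [q, if_true, Bool.false_eq_true, if_false]
    ring
  simp only [term_eq]
  refine ⟨fun j k => ⟨hpos (j, true) k, hpos (j, false) k⟩,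
    fun j => (hsum (j, true)).add (hsum (j, false)), fun a ha => ?_⟩
  rw [← sum_mul_tsum_prod_bool (fun j => faceArea a j / area a) hsum]
  exact isSurfacePressure_of_isCavityMarginal hd hsymm hs hx hExp hp hq ha
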